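/- **Uniqueness of weak solutions (Robin/Neumann and reaction–diffusion cases).** Let $T>0$, $\alpha,\beta\in[0,1]$, and let $g:[0,1]\to[0,1]$ be measurable. Write $\langle f,h\rangle=\int_0^1 f(u)h(u)\,du$. Let $C^{1,2}([0,T]\times[0,1])$ be the set of functions $G$ such that $G,\partial_tG,\partial_uG,\Delta G=\partial_u^2G$ exist and are continuous on $[0,T]\times[0,1]$ (one-sided derivatives at the boundary), and let $C^{1,2}_c([0,T]\times(0,1))$ be the subset of those with compact support in $[0,T]\times(0,1)$. For $c\ge 0$, a measurable $\rho:[0,T]\times[0,1]\to[0,1]$ with measurable time slices $\rho_t$, and $G\in C^{1,2}([0,T]\times[0,1])$, put $$F_c(t,\rho,G,g)=\langle\rho_t,G_t\rangle-\langle g,G_0\rangle-\int_0^t\langle\rho_s,(\partial_s+c\,\Delta)G_s\rangle\,ds .$$ (i) (Robin/Neumann.) Let $c>0$, $m\ge0$. Call $\rho$ a weak solution of $\partial_t\rho=c\,\Delta\rho$ with boundary conditions $\partial_u\rho_t(0)=\frac mc(\rho_t(0)-\alpha)$, $\partial_u\rho_t(1)=\frac mc(\beta-\rho_t(1))$ and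 initial condition $g$ if $F_c(t,\rho,G,g)=0$ for all $t\in[0,T]$ and all $G\in C^{1,2}([0,T]\times[0,1])$ with $\partial_uG_s(0)=\frac mc(G_s(0)-\alpha)$ and $\partial_uG_s(1)=\frac mc(\beta-G_s(1))$ for all $s\in[0,T]$. If $\rho^1,\rho^2$ are two such weak solutions with the same initial condition $g$, then for every $t\in[0,T]$, $\rho^1_t=\rho^2_t$ almost everywhere on $[0,1]$. (ii) The same conclusion holds for the formulation of the same problem in which one requires instead $$F_c(t,\rho,G,g)-m\int_0^t\big(\alpha G_s(0)+\beta G_s(1)\big)\,ds=0$$ for all $t\in[0,T]$ and all $G\in C^{1,2}([0,T]\times[0,1])$ with $\partial_uG_s(0)=\frac mc G_s(0)$ and $\partial_uG_s(1)=-\frac mc G_s(1)$ for all $s\in[0,T]$. (For $\alpha=\beta=0$ or $m=0$ the formulations (i) and (ii) coincide.) (iii) (Reaction–diffusion with Dirichlet conditions.) Let $c\ge0$, $\kappa>0$, $c_2=\big(\sum_{z\in\mathbb Z\setminus\{0\}}|z|^{-3}\big)^{-1}$, $r^-(u)=\frac{c_2}{2u^2}$, $r^+(u)=\frac{c_2}{2(1-u)^2}$,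 $V_0=\alpha r^-+\beta r^+$, $V_1=r^-+r^+$. Call $\rho$ a weak solution of $\partial_t\rho=c\,\Delta\rho+\kappa(V_0-V_1\rho)$ with boundary values $\rho_t(0)=\alpha$, $\rho_t(1)=\beta$ and initial condition $g$ if $$\int_0^T\!\!\int_0^1\Big\{\frac{(\alpha-\rho_s(u))^2}{u^2}+\frac{(\beta-\rho_s(u))^2}{(1-u)^2}\Big\}\,du\,ds<\infty$$ and, for all $t\in[0,T]$ and all $G\in C_c^{1,2}([0,T]\times(0,1))$, $$F_c(t,\rho,G,g)+\kappa\int_0^t\!\int_0^1G_s(u)\big(V_0(u)-V_1(u)\rho_s(u)\big)\,du\,ds=0 .$$ If $\rho^1,\rho^2$ are two such weak solutions with the same initial condition $g$, then for every $t\in[0,T]$, $\rho^1_t=\rho^2_t$ almost everywhere on $[0,1]$. -/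

import Mathlib

open MeasureTheory Set

namespace WeakSol

noncomputable section

/-- The pairing `⟨f, h⟩ = ∫₀¹ f(u) h(u) du`. -/
def pair (f h : ℝ → ℝ) : ℝ := ∫ u in (0 : ℝ)..1, f u * h u

/-- Time derivative `∂ₜG` on `[0,T]` (one-sided at the end points). -/
def dt (T : ℝ) (G : ℝ → ℝ → ℝ) (t u : ℝ) : ℝ := derivWithin (fun s => G s u) (Icc 0 T) t

/-- First space derivative `∂ᵤG` on `[0,1]` (one-sided at the end points). -/
def du (G : ℝ → ℝ → ℝ) (t u : ℝ) : ℝ := derivWithin (G t) (Icc 0 1) u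

/-- Second space derivative `ΔG = ∂ᵤ∂ᵤG` on `[0,1]` (one-sided at the end points). -/
def duu (G : ℝ → ℝ → ℝ) : ℝ → ℝ → ℝ := du (du G)

/-- `G` is of class `C^{1,2}` on `[0,T] × [0,1]`: the derivatives `∂ₜG`, `∂ᵤG`, `∂ᵤ∂ᵤG` exist, and
they and `G` are continuous on `[0,T] × [0,1]`. -/
structure C12 (T : ℝ) (G : ℝ → ℝ → ℝ) : Prop where
  diff_t : ∀ u ∈ Icc (0 : ℝ) 1, DifferentiableOn ℝ (fun t => G t u) (Icc 0 T)
  diff_u : ∀ t ∈ Icc (0 : ℝ) T, DifferentiableOn ℝ (G t) (Icc 0 1)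
  diff_uu : ∀ t ∈ Icc (0 : ℝ) T, DifferentiableOn ℝ (du G t) (Icc 0 1)
  cont : ContinuousOn (fun p : ℝ × ℝ => G p.1 p.2) (Icc 0 T ×ˢ Icc 0 1)
  cont_t : ContinuousOn (fun p : ℝ × ℝ => dt T G p.1 p.2) (Icc 0 T ×ˢ Icc 0 1)
  cont_u : ContinuousOn (fun p : ℝ × ℝ => du G p.1 p.2) (Icc 0 T ×ˢ Icc 0 1)
  cont_uu : ContinuousOn (fun p : ℝ × ℝ => duu G p.1 p.2) (Icc 0 T ×ˢ Icc 0 1)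

/-- `C_c^{1,2}([0,T] × (0,1))`: a function with compact support in `[0,T] × (0,1)`
extends by zero to `[0,T] × [0,1]`. -/
structure C12c (T : ℝ) (G : ℝ → ℝ → ℝ) : Prop where
  c12 : C12 T G
  supp : ∃ K : Set ℝ, IsCompact K ∧ K ⊆ Ioo 0 1 ∧
    ∀ t ∈ Icc (0 : ℝ) T, ∀ u ∈ Icc (0 : ℝ) 1, u ∉ K → G t u = 0

/-- The test functions `S_Rob(m, c)` with boundary data `α`, `β`. -/
structure RobinTest (T m c α β : ℝ) (G : ℝ → ℝ → ℝ) : Prop where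
  c12 : C12 T G
  bdry_one : ∀ t ∈ Icc (0 : ℝ) T, du G t 1 = m / c * (β - G t 1)
  bdry_zero : ∀ t ∈ Icc (0 : ℝ) T, du G t 0 = m / c * (G t 0 - α)

/-- The part common to all the integral formulations:
`⟨ρ_t, G_t⟩ - ⟨g, G_0⟩ - ∫₀ᵗ ⟨ρ_s, (∂_s + c Δ) G_s⟩ ds`. -/
def heatFunctional (T c : ℝ) (ρ : ℝ → ℝ → ℝ) (g : ℝ → ℝ) (G : ℝ → ℝ → ℝ) (t : ℝ) : ℝ :=
  pair (ρ t) (G t) - pair g (G 0)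
    - ∫ s in (0 : ℝ)..t, pair (ρ s) (fun u => dt T G s u + c * duu G s u)

/-- `ρ : [0,T] × [0,1] → [0,1]`, (Lebesgue) measurable, with measurable time slices. -/
structure IsDensity (T : ℝ) (ρ : ℝ → ℝ → ℝ) : Prop where
  mem : ∀ t ∈ Icc (0 : ℝ) T, ∀ u ∈ Icc (0 : ℝ) 1, ρ t u ∈ Icc (0 : ℝ) 1
  meas : AEMeasurable (fun p : ℝ × ℝ => ρ p.1 p.2) (volume.restrict (Icc 0 T ×ˢ Icc 0 1))
  meas_slice : ∀ t ∈ Icc (0 : ℝ) T, AEMeasurable (ρ t) (volume.restrict (Icc 0 1))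

/-- Weak solution of the heat equation with Robin boundary conditions (Neumann for `m = 0`),
tested against `S_Rob(m, c)`, whose elements obey the same boundary conditions as the solution. -/
structure IsWeakSolRobin (T c m α β : ℝ) (g : ℝ → ℝ) (ρ : ℝ → ℝ → ℝ) : Prop where
  density : IsDensity T ρ
  weak : ∀ t ∈ Icc (0 : ℝ) T, ∀ G : ℝ → ℝ → ℝ, RobinTest T m c α β G →
    heatFunctional T c ρ g G t = 0

/-- Weak solution of the same equation, in the form obtained from it by integration by parts:
the test functions obey the homogeneous Robin conditions, and the boundary data `α`, `β` enter
through the term `m ∫₀ᵗ (α G_s(0) + β G_s(1)) ds`. -/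
structure IsWeakSolRobinHom (T c m α β : ℝ) (g : ℝ → ℝ) (ρ : ℝ → ℝ → ℝ) : Prop where
  density : IsDensity T ρ
  weak : ∀ t ∈ Icc (0 : ℝ) T, ∀ G : ℝ → ℝ → ℝ, RobinTest T m c 0 0 G →
    heatFunctional T c ρ g G t - m * ∫ s in (0 : ℝ)..t, (α * G s 0 + β * G s 1) = 0

/-- The normalizing constant `c₂ = (∑_{z ≠ 0} |z|⁻³)⁻¹` of the jump probability. -/
def c₂ : ℝ := (∑' z : {z : ℤ // z ≠ 0}, 1 / |((z : ℤ) : ℝ)| ^ 3)⁻¹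

def rMinus (u : ℝ) : ℝ := c₂ / (2 * u ^ 2)

def rPlus (u : ℝ) : ℝ := c₂ / (2 * (1 - u) ^ 2)

def V₀ (α β u : ℝ) : ℝ := α * rMinus u + β * rPlus u

def V₁ (u : ℝ) : ℝ := rMinus u + rPlus u

/-- Weak solution of `∂ₜρ = c Δρ + κ (V₀ - V₁ ρ)` with Dirichlet boundary values `α`, `β`. -/
structure IsWeakSolReac (T c κ α β : ℝ) (g : ℝ → ℝ) (ρ : ℝ → ℝ → ℝ) : Prop where
  density : IsDensity T ρ
  energy : 0 < κ → ∫⁻ s in Icc (0 : ℝ) T, ∫⁻ u in Ioo (0 : ℝ) 1,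
    ENNReal.ofReal ((α - ρ s u) ^ 2 / u ^ 2 + (β - ρ s u) ^ 2 / (1 - u) ^ 2) < ⊤
  weak : ∀ t ∈ Icc (0 : ℝ) T, ∀ G : ℝ → ℝ → ℝ, C12c T G →
    heatFunctional T c ρ g G t
      + κ * ∫ s in (0 : ℝ)..t, pair (G s) (fun u => V₀ α β u - V₁ u * ρ s u) = 0
  dirichlet : 0 < c → κ = 0 →
    ∀ᵐ t ∂(volume.restrict (Ioc (0 : ℝ) T)), ρ t 0 = α ∧ ρ t 1 = β

end

end WeakSol

/-!
# Uniqueness of weak solutions by symmetry and reflection in time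

Let `d_t = ρ¹_t - ρ²_t` be the difference of two weak solutions and `W_t = ∫₀ᵗ d_s ds`
(`timeIntegral`). Test functions that do not depend on time suffice. They say that `d_t = A W_t`
weakly, where `A = c Δ` with homogeneous Robin conditions, or `A = c Δ + κ V₁` in the interior.
(In the Robin formulation with inhomogeneous test functions, the affine stationary profile is
subtracted first.)

Only the symmetry of `A` is used, not its sign: in the reaction term the potential `κ V₁` enters as
growth, it is not bounded, and `A` need not be bounded above. Symmetry means `∫ d_s W_t = ∫ W_s d_t`
for all `s`, `t`. Then `s ↦ ∫ W_s W_{2t-s}` has derivative zero, so that `∫ W_t² = ∫ W_0 W_{2t} = 0`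
for `t ≤ T / 2`. Starting again from the time reached, the remaining distance to `T` is halved at each
step, and `W = 0` follows on `[0, T]` (`timeIntegral_ae_eq_zero`). Then `d_t = A W_t = 0` for every
`t`.

To prove the symmetry, `c W'' = f` weakly is upgraded, by the du Bois-Reymond lemma applied twice, to
the statement that `W` has an absolutely continuous derivative
(`exists_hasACDeriv_of_forall_integral_eq`). Under Robin conditions test functions that see one end
point give the boundary conditions for `W`, and the boundary terms in Green's formula cancel
(`integral_mul_sub_mul_eq_zero_of_robin`). For the reaction–diffusion equation smooth cutoffs `χ_n`
with `|χ_n'| ≤ C / (u (1 - u))` are used (`cutoff`). The error is at most a multiple of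
`‖χ_n' W‖ ‖χ_n W'‖` in `L²`. The second factor is bounded by Caccioppoli's inequality
(`integral_sq_mul_deriv_sq_le`), and the first tends to zero because the energy condition makes
`W² / u² + W² / (1 - u)²` integrable (`integral_sq_mul_sub_le_of_reaction`,
`tendsto_integral_deriv_cutoff_sq_mul`). Without diffusion, `d_t = κ V₁ W_t` holds almost everywhere
and the symmetry is exact.
-/

namespace WeakSol

open Filter Topology
open scoped ContDiff

/-! ### Functions with prescribed second distributional derivative -/

theorem exists_subset_Icc_of_isCompact_subset_Ioo {a b : ℝ} (hab : a < b) {K : Set ℝ}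
    (hK : IsCompact K) (h : K ⊆ Ioo a b) : ∃ a' b', a < a' ∧ a' ≤ b' ∧ b' < b ∧ K ⊆ Icc a' b' := by
  rcases K.eq_empty_or_nonempty with rfl | hne
  · exact ⟨(a + b) / 2, (a + b) / 2, by linarith, le_rfl, by linarith, empty_subset _⟩
  · obtain ⟨x, hx⟩ := hK.exists_isLeast hne
    obtain ⟨y, hy⟩ := hK.exists_isGreatest hne
    exact ⟨x, y, (h hx.1).1, hx.2 hy.1, (h hy.1).2, fun z hz => ⟨hx.2 hz, hy.2 hz⟩⟩

theorem exists_primitive_of_integral_eq_zero {a b : ℝ} (hab : a < b) {θ : ℝ → ℝ}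
    (hθ : ContDiff ℝ ∞ θ) (hc : HasCompactSupport θ) (hs : tsupport θ ⊆ Ioo a b)
    (h0 : ∫ u in a..b, θ u = 0) :
    ∃ φ : ℝ → ℝ, ContDiff ℝ ∞ φ ∧ HasCompactSupport φ ∧ tsupport φ ⊆ Ioo a b ∧ deriv φ = θ := by
  obtain ⟨a', b', haa, hab', hbb, hK⟩ := exists_subset_Icc_of_isCompact_subset_Ioo hab hc hs
  have hz : ∀ u, u ∉ Icc a' b' → θ u = 0 := fun u hu =>
    image_eq_zero_of_notMem_tsupport fun h => hu (hK h)
  have hd : deriv (fun u => ∫ x in a..u, θ x) = θ := by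
    ext u
    exact hθ.continuous.deriv_integral _ _ _
  have hsupp : tsupport (fun u => ∫ x in a..u, θ x) ⊆ Icc a' b' := by
    apply closure_minimal _ isClosed_Icc
    intro u hu
    by_contra hn
    apply hu
    rcases lt_or_ge u a' with h | h
    · apply intervalIntegral.integral_zero_ae
      refine Eventually.of_forall fun x hx => hz x fun hx' => ?_
      have h1 := hx.2
      have h2 := hx'.1
      rcases max_cases a u with h3 | h3 <;> linarith
    · have h' : b' < u := by
        by_contra h3
        exact hn ⟨h, not_lt.1 h3⟩
      have h3 : ∫ x in u..b, θ x = 0 := by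
        apply intervalIntegral.integral_zero_ae
        refine Eventually.of_forall fun x hx => hz x fun hx' => ?_
        have h1 := hx.1
        have h2 := hx'.2
        rcases min_cases u b with h3 | h3 <;> linarith
      have h4 := intervalIntegral.integral_add_adjacent_intervals
        (hθ.continuous.intervalIntegrable (μ := volume) a u)
        (hθ.continuous.intervalIntegrable u b)
      show ∫ x in a..u, θ x = 0
      linarith
  refine ⟨fun u => ∫ x in a..u, θ x, ?_, ?_, ?_, hd⟩
  · rw [contDiff_infty_iff_deriv, hd]
    exact ⟨fun u => (hθ.continuous.integral_hasStrictDerivAt a u).hasDerivAt.differentiableAt, hθ⟩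
  · exact isCompact_Icc.of_isClosed_subset (isClosed_tsupport _) hsupp
  · exact hsupp.trans fun x hx => ⟨haa.trans_le hx.1, hx.2.trans_lt hbb⟩

theorem ae_mem_uIoc_of_ae_mem_Ioo {a b : ℝ} (hab : a ≤ b) {p : ℝ → Prop}
    (h : ∀ᵐ u, u ∈ Ioo a b → p u) : ∀ᵐ u, u ∈ uIoc a b → p u := by
  have hne : ∀ᵐ u : ℝ, u ≠ b := by simp [ae_iff]
  filter_upwards [h, hne] with u h1 h2 h3
  rw [uIoc_of_le hab] at h3
  exact h1 ⟨h3.1, lt_of_le_of_ne h3.2 h2⟩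

/-- A function integrable on `(a, b)` that is orthogonal to all smooth functions with compact
support in `(a, b)` vanishes there. -/
theorem ae_eq_zero_of_forall_integral_mul_eq_zero {a b : ℝ} (hab : a < b) {f : ℝ → ℝ}
    (hf : IntervalIntegrable f volume a b)
    (h : ∀ φ : ℝ → ℝ, ContDiff ℝ ∞ φ → HasCompactSupport φ → tsupport φ ⊆ Ioo a b →
      ∫ u in a..b, f u * φ u = 0) : ∀ᵐ u, u ∈ Ioo a b → f u = 0 := by
  have hf' : IntegrableOn f (Ioo a b) :=
    ((intervalIntegrable_iff_integrableOn_Ioc_of_le hab.le).1 hf).mono_set Ioo_subset_Ioc_self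
  refine isOpen_Ioo.ae_eq_zero_of_integral_contDiff_smul_eq_zero
    hf'.locallyIntegrableOn fun φ h1 h2 h3 => ?_
  rw [← h φ h1 h2 h3, intervalIntegral.integral_of_le hab.le]
  rw [← setIntegral_eq_integral_of_forall_compl_eq_zero (s := Ioc a b)]
  · simp only [smul_eq_mul, mul_comm]
  · intro x hx
    rw [image_eq_zero_of_notMem_tsupport fun hx' => hx (Ioo_subset_Ioc_self (h3 hx')), zero_smul]

/-- A bump function of integral one supported in `(a, b)`. -/
theorem exists_contDiff_integral_eq_one {a b : ℝ} (hab : a < b) :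
    ∃ η : ℝ → ℝ, ContDiff ℝ ∞ η ∧ HasCompactSupport η ∧ tsupport η ⊆ Ioo a b ∧
      ∫ u in a..b, η u = 1 := by
  let B : ContDiffBump ((a + b) / 2) :=
    { rIn := (b - a) / 8, rOut := (b - a) / 4, rIn_pos := by linarith, rIn_lt_rOut := by linarith }
  have hs : tsupport (B.normed volume) ⊆ Ioo a b := by
    rw [B.tsupport_normed_eq, Real.closedBall_eq_Icc]
    intro x hx
    have h1 := hx.1
    have h2 := hx.2
    simp only [B] at h1 h2
    constructor <;> linarith
  refine ⟨B.normed volume, B.contDiff_normed, B.hasCompactSupport_normed, hs, ?_⟩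
  rw [← B.integral_normed (μ := volume), intervalIntegral.integral_of_le hab.le]
  exact setIntegral_eq_integral_of_forall_compl_eq_zero fun x hx =>
    image_eq_zero_of_notMem_tsupport fun hx' => hx (Ioo_subset_Ioc_self (hs hx'))

/-- The du Bois-Reymond lemma: a function with vanishing distributional derivative is constant. -/
theorem ae_eq_const_of_forall_integral_mul_deriv_eq_zero {a b : ℝ} (hab : a < b) {f : ℝ → ℝ}
    (hf : IntervalIntegrable f volume a b)
    (h : ∀ φ : ℝ → ℝ, ContDiff ℝ ∞ φ → HasCompactSupport φ → tsupport φ ⊆ Ioo a b →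
      ∫ u in a..b, f u * deriv φ u = 0) : ∃ C, ∀ᵐ u, u ∈ Ioo a b → f u = C := by
  obtain ⟨η, hη, hηc, hηs, hη1⟩ := exists_contDiff_integral_eq_one hab
  refine ⟨∫ u in a..b, f u * η u, ?_⟩
  set C := ∫ u in a..b, f u * η u with hC
  have key := ae_eq_zero_of_forall_integral_mul_eq_zero hab
    (hf.sub (intervalIntegrable_const (c := C))) ?_
  · filter_upwards [key] with u hu hu'
    have := hu hu'
    linarith
  intro ψ hψ hψc hψs
  set J := ∫ u in a..b, ψ u with hJ
  have iψ : IntervalIntegrable ψ volume a b := hψ.continuous.intervalIntegrable a b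
  have iη : IntervalIntegrable η volume a b := hη.continuous.intervalIntegrable a b
  have ifψ := hf.mul_continuousOn hψ.continuous.continuousOn
  have ifη := hf.mul_continuousOn hη.continuous.continuousOn
  have hsupp : tsupport (fun u => ψ u - J * η u) ⊆ tsupport ψ ∪ tsupport η := by
    refine closure_minimal (fun u hu => ?_) ((isClosed_tsupport _).union (isClosed_tsupport _))
    by_contra hn
    rw [mem_union, not_or] at hn
    exact hu (by simp [image_eq_zero_of_notMem_tsupport hn.1, image_eq_zero_of_notMem_tsupport hn.2])
  obtain ⟨φ, hφ, hφc, hφs, hφd⟩ := exists_primitive_of_integral_eq_zero hab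
    (θ := fun u => ψ u - J * η u) (hψ.sub (contDiff_const.mul hη))
    ((hψc.isCompact.union hηc.isCompact).of_isClosed_subset (isClosed_tsupport _) hsupp)
    (hsupp.trans (union_subset hψs hηs))
    (by rw [intervalIntegral.integral_sub iψ (iη.const_mul J),
          intervalIntegral.integral_const_mul, hη1, ← hJ]; ring)
  have h1 := h φ hφ hφc hφs
  rw [hφd] at h1
  have e1 : ∫ u in a..b, f u * (ψ u - J * η u) = (∫ u in a..b, f u * ψ u) - J * C := by
    rw [hC, ← intervalIntegral.integral_const_mul, ← intervalIntegral.integral_sub ifψ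
      (ifη.const_mul J)]
    congr 1; ext u; ring
  have e2 : ∫ u in a..b, (f u - C) * ψ u = (∫ u in a..b, f u * ψ u) - C * J := by
    rw [hJ, ← intervalIntegral.integral_const_mul, ← intervalIntegral.integral_sub ifψ
      (iψ.const_mul C)]
    congr 1; ext u; ring
  rw [e2]
  linarith [h1, e1]

/-- The second order version: a function whose second distributional derivative vanishes is
affine. -/
theorem ae_eq_affine_of_forall_integral_mul_deriv_deriv_eq_zero {a b : ℝ} (hab : a < b)
    {f : ℝ → ℝ} (hf : IntervalIntegrable f volume a b)
    (h : ∀ φ : ℝ → ℝ, ContDiff ℝ ∞ φ → HasCompactSupport φ → tsupport φ ⊆ Ioo a b →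
      ∫ u in a..b, f u * deriv (deriv φ) u = 0) :
    ∃ A B, ∀ᵐ u, u ∈ Ioo a b → f u = A + B * u := by
  obtain ⟨η, hη, hηc, hηs, hη1⟩ := exists_contDiff_integral_eq_one hab
  set C := ∫ u in a..b, f u * deriv η u with hC
  have hη' : ContDiff ℝ ∞ (deriv η) := (contDiff_infty_iff_deriv.1 hη).2
  have iη : IntervalIntegrable η volume a b := hη.continuous.intervalIntegrable a b
  have ifη := hf.mul_continuousOn hη'.continuous.continuousOn
  have key := ae_eq_const_of_forall_integral_mul_deriv_eq_zero hab (f := fun u => f u + C * u)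
    (hf.add (Continuous.intervalIntegrable (by fun_prop) a b)) ?_
  · obtain ⟨A, hA⟩ := key
    refine ⟨A, -C, ?_⟩
    filter_upwards [hA] with u hu hu'
    linarith [hu hu']
  intro ψ hψ hψc hψs
  have hψ' : ContDiff ℝ ∞ (deriv ψ) := (contDiff_infty_iff_deriv.1 hψ).2
  set J := ∫ u in a..b, ψ u with hJ
  have iψ : IntervalIntegrable ψ volume a b := hψ.continuous.intervalIntegrable a b
  have ifψ := hf.mul_continuousOn hψ'.continuous.continuousOn
  have hsupp : tsupport (fun u => ψ u - J * η u) ⊆ tsupport ψ ∪ tsupport η := by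
    refine closure_minimal (fun u hu => ?_) ((isClosed_tsupport _).union (isClosed_tsupport _))
    by_contra hn
    rw [mem_union, not_or] at hn
    exact hu (by simp [image_eq_zero_of_notMem_tsupport hn.1, image_eq_zero_of_notMem_tsupport hn.2])
  obtain ⟨φ, hφ, hφc, hφs, hφd⟩ := exists_primitive_of_integral_eq_zero hab
    (θ := fun u => ψ u - J * η u) (hψ.sub (contDiff_const.mul hη))
    ((hψc.isCompact.union hηc.isCompact).of_isClosed_subset (isClosed_tsupport _) hsupp)
    (hsupp.trans (union_subset hψs hηs))
    (by rw [intervalIntegral.integral_sub iψ (iη.const_mul J),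
          intervalIntegral.integral_const_mul, hη1, ← hJ]; ring)
  have h1 := h φ hφ hφc hφs
  have hdd : deriv (deriv φ) = fun u => deriv ψ u - J * deriv η u := by
    rw [hφd]
    ext u
    have d1 : DifferentiableAt ℝ ψ u := (contDiff_infty_iff_deriv.1 hψ).1 u
    have d2 : DifferentiableAt ℝ η u := (contDiff_infty_iff_deriv.1 hη).1 u
    exact (d1.hasDerivAt.sub (d2.hasDerivAt.const_mul J)).deriv
  rw [hdd] at h1
  have e1 : ∫ u in a..b, f u * (deriv ψ u - J * deriv η u)
      = (∫ u in a..b, f u * deriv ψ u) - J * C := by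
    rw [hC, ← intervalIntegral.integral_const_mul, ← intervalIntegral.integral_sub ifψ
      (ifη.const_mul J)]
    congr 1; ext u; ring
  have z : ∀ u, u ∉ Ioo a b → ψ u = 0 := fun u hu =>
    image_eq_zero_of_notMem_tsupport fun h => hu (hψs h)
  have parts : ∫ u in a..b, u * deriv ψ u = - J := by
    rw [intervalIntegral.integral_mul_deriv_eq_deriv_mul (u := fun u => u) (u' := fun _ => 1)
      (fun u _ => hasDerivAt_id u)
      (fun u _ => ((contDiff_infty_iff_deriv.1 hψ).1 u).hasDerivAt) (by simp)
      (hψ'.continuous.intervalIntegrable a b)]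
    simp [z a (by simp), z b (by simp), hJ]
  have e2 : ∫ u in a..b, (f u + C * u) * deriv ψ u
      = (∫ u in a..b, f u * deriv ψ u) + C * ∫ u in a..b, u * deriv ψ u := by
    rw [← intervalIntegral.integral_const_mul, ← intervalIntegral.integral_add ifψ
      ((Continuous.intervalIntegrable (u := fun u => u * deriv ψ u)
        (continuous_id.mul hψ'.continuous) a b).const_mul C)]
    congr 1; ext u; ring
  rw [e2, parts]
  linarith [h1, e1]

/-- `f` is absolutely continuous on the interval between `a` and `b`, with almost everywhere
derivative `f'`. -/
structure HasACDeriv (a b : ℝ) (f f' : ℝ → ℝ) : Prop where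
  ac : AbsolutelyContinuousOnInterval f a b
  ae_hasDerivAt : ∀ᵐ u, u ∈ uIcc a b → HasDerivAt f (f' u) u

namespace HasACDeriv

variable {a b : ℝ} {f f' g g' : ℝ → ℝ}

theorem ae_deriv_eq (hf : HasACDeriv a b f f') :
    ∀ᵐ u, u ∈ uIoc a b → deriv f u = f' u := by
  filter_upwards [hf.ae_hasDerivAt] with u hu hu'
  exact (hu (uIoc_subset_uIcc hu')).deriv

theorem intervalIntegrable (hf : HasACDeriv a b f f') : IntervalIntegrable f' volume a b :=
  hf.ac.intervalIntegrable_deriv.congr_ae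
    ((ae_restrict_iff' measurableSet_uIoc).2 hf.ae_deriv_eq)

theorem integral_eq_sub (hf : HasACDeriv a b f f') : ∫ u in a..b, f' u = f b - f a := by
  rw [← hf.ac.integral_deriv_eq_sub]
  refine intervalIntegral.integral_congr_ae ?_
  filter_upwards [hf.ae_deriv_eq] with u hu hu'
  exact (hu hu').symm

theorem mul (hf : HasACDeriv a b f f') (hg : HasACDeriv a b g g') :
    HasACDeriv a b (fun u => f u * g u) (fun u => f' u * g u + f u * g' u) := by
  refine ⟨hf.ac.fun_mul hg.ac, ?_⟩
  filter_upwards [hf.ae_hasDerivAt, hg.ae_hasDerivAt] with u h1 h2 hu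
  exact (h1 hu).mul (h2 hu)

theorem sub (hf : HasACDeriv a b f f') (hg : HasACDeriv a b g g') :
    HasACDeriv a b (fun u => f u - g u) (fun u => f' u - g' u) := by
  refine ⟨hf.ac.sub hg.ac, ?_⟩
  filter_upwards [hf.ae_hasDerivAt, hg.ae_hasDerivAt] with u h1 h2 hu
  exact (h1 hu).sub (h2 hu)

theorem add (hf : HasACDeriv a b f f') (hg : HasACDeriv a b g g') :
    HasACDeriv a b (fun u => f u + g u) (fun u => f' u + g' u) := by
  refine ⟨hf.ac.add hg.ac, ?_⟩
  filter_upwards [hf.ae_hasDerivAt, hg.ae_hasDerivAt] with u h1 h2 hu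
  exact (h1 hu).add (h2 hu)

theorem mono (hf : HasACDeriv a b f f') {x y : ℝ} (h : uIcc x y ⊆ uIcc a b) :
    HasACDeriv x y f f' := by
  refine ⟨hf.ac.mono h, ?_⟩
  filter_upwards [hf.ae_hasDerivAt] with u hu hu'
  exact hu (h hu')

theorem of_contDiff (a b : ℝ) (hf : ContDiff ℝ 1 f) : HasACDeriv a b f (deriv f) :=
  ⟨hf.contDiffOn.absolutelyContinuousOnInterval,
    Eventually.of_forall fun u _ => (hf.differentiable one_ne_zero u).hasDerivAt⟩

theorem of_integral (hf : IntervalIntegrable f volume a b) :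
    HasACDeriv a b (fun u => ∫ x in a..u, f x) f := by
  refine ⟨hf.absolutelyContinuousOnInterval_intervalIntegral (by simp), ?_⟩
  filter_upwards [hf.ae_hasDerivAt_integral] with u hu hu'
  exact hu hu' a (by simp)

end HasACDeriv

/-- Green's formula. -/
theorem integral_mul_deriv_deriv_sub_integral_mul {a b : ℝ} {w P q φ : ℝ → ℝ}
    (hw : HasACDeriv a b w P) (hP : HasACDeriv a b P q) (hφ : ContDiff ℝ 2 φ) :
    (∫ u in a..b, w u * deriv (deriv φ) u) - ∫ u in a..b, q u * φ u
      = (w b * deriv φ b - P b * φ b) - (w a * deriv φ a - P a * φ a) := by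
  have h1 : ContDiff ℝ 1 φ := hφ.of_le (by norm_num)
  have h2 : ContDiff ℝ 1 (deriv φ) := (contDiff_succ_iff_deriv (n := 1)).1 hφ |>.2.2
  have h3 : Continuous (deriv (deriv φ)) := h2.continuous_deriv le_rfl
  rw [← ((hw.mul (.of_contDiff a b h2)).sub (hP.mul (.of_contDiff a b h1))).integral_eq_sub,
    ← intervalIntegral.integral_sub (hw.ac.continuousOn.intervalIntegrable.mul_continuousOn
      h3.continuousOn) (hP.intervalIntegrable.mul_continuousOn h1.continuous.continuousOn)]
  congr 1; ext u; ring

/-- If `W'' = q` in the sense of distributions with `q` integrable, then `W` agrees almost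
everywhere with a function `w` that has an absolutely continuous derivative `P` with `P' = q`. -/
theorem exists_hasACDeriv_of_forall_integral_eq {a b : ℝ} (hab : a < b) {W q : ℝ → ℝ}
    (hW : IntervalIntegrable W volume a b) (hq : IntervalIntegrable q volume a b)
    (h : ∀ φ : ℝ → ℝ, ContDiff ℝ ∞ φ → HasCompactSupport φ → tsupport φ ⊆ Ioo a b →
      ∫ u in a..b, W u * deriv (deriv φ) u = ∫ u in a..b, q u * φ u) :
    ∃ w P, HasACDeriv a b w P ∧ HasACDeriv a b P q ∧ ∀ᵐ u, u ∈ uIoc a b → W u = w u := by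
  set P₀ : ℝ → ℝ := fun u => ∫ x in a..u, q x with hP₀
  have h1 : HasACDeriv a b P₀ q := .of_integral hq
  set w₀ : ℝ → ℝ := fun u => ∫ x in a..u, P₀ x with hw₀
  have h2 : HasACDeriv a b w₀ P₀ := .of_integral h1.ac.continuousOn.intervalIntegrable
  obtain ⟨A, B, hAB⟩ := ae_eq_affine_of_forall_integral_mul_deriv_deriv_eq_zero hab
    (hW.sub h2.ac.continuousOn.intervalIntegrable) (fun φ hφ hφc hφs => by
      have hd : ContDiff ℝ ∞ (deriv (deriv φ)) :=
        (contDiff_infty_iff_deriv.1 (contDiff_infty_iff_deriv.1 hφ).2).2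
      have e := integral_mul_deriv_deriv_sub_integral_mul h2 h1 (contDiff_infty.1 hφ 2)
      have z : ∀ u, u ∉ Ioo a b → φ u = 0 := fun u hu =>
        image_eq_zero_of_notMem_tsupport fun h => hu (hφs h)
      have z' : ∀ u, u ∉ Ioo a b → deriv φ u = 0 := fun u hu =>
        image_eq_zero_of_notMem_tsupport fun h => hu (hφs (tsupport_deriv_subset h))
      rw [z a (by simp), z b (by simp), z' a (by simp), z' b (by simp)] at e
      have e' : ∫ u in a..b, (W u - w₀ u) * deriv (deriv φ) u
          = (∫ u in a..b, W u * deriv (deriv φ) u) - ∫ u in a..b, w₀ u * deriv (deriv φ) u := by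
        rw [← intervalIntegral.integral_sub (hW.mul_continuousOn hd.continuous.continuousOn)
          (h2.ac.continuousOn.intervalIntegrable.mul_continuousOn hd.continuous.continuousOn)]
        congr 1; ext u; ring
      rw [e', h φ hφ hφc hφs]
      linarith)
  have dA : deriv (fun u : ℝ => A + B * u) = fun _ => B := by
    ext u; simp
  have hA : HasACDeriv a b (fun u => A + B * u) (fun _ => B) := by
    have := HasACDeriv.of_contDiff a b (f := fun u => A + B * u) (by fun_prop)
    rwa [dA] at this
  have hB : HasACDeriv a b (fun _ => B) (fun _ => 0) := by
    have := HasACDeriv.of_contDiff a b (f := fun _ => B) (by fun_prop)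
    simpa using this
  refine ⟨fun u => w₀ u + (A + B * u), fun u => P₀ u + B, h2.add hA, by simpa using h1.add hB,
    ae_mem_uIoc_of_ae_mem_Ioo hab.le ?_⟩
  filter_upwards [hAB] with u hu hu'
  have := hu hu'
  linarith

theorem abs_integral_mul_le_sqrt_mul_sqrt {a b : ℝ} (hab : a ≤ b) {f g : ℝ → ℝ}
    (hf : IntervalIntegrable (fun u => f u ^ 2) volume a b)
    (hg : IntervalIntegrable (fun u => g u ^ 2) volume a b)
    (hfg : IntervalIntegrable (fun u => f u * g u) volume a b) :
    |∫ u in a..b, f u * g u| ≤ √(∫ u in a..b, f u ^ 2) * √(∫ u in a..b, g u ^ 2) := by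
  have hd := discrim_le_zero (a := ∫ u in a..b, g u ^ 2) (b := 2 * ∫ u in a..b, f u * g u)
    (c := ∫ u in a..b, f u ^ 2) fun x => by
      have h0 : 0 ≤ ∫ u in a..b, (x * g u + f u) ^ 2 :=
        intervalIntegral.integral_nonneg hab fun u _ => sq_nonneg _
      have e : ∀ u, (x * g u + f u) ^ 2 = (x ^ 2 * g u ^ 2 + 2 * x * (f u * g u)) + f u ^ 2 := by
        intro u; ring
      simp_rw [e] at h0
      rw [intervalIntegral.integral_add ((hg.const_mul _).add (hfg.const_mul _)) hf,
        intervalIntegral.integral_add (hg.const_mul _) (hfg.const_mul _),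
        intervalIntegral.integral_const_mul, intervalIntegral.integral_const_mul] at h0
      linarith
  rw [← Real.sqrt_mul (intervalIntegral.integral_nonneg hab fun u _ => sq_nonneg _)]
  refine Real.abs_le_sqrt ?_
  rw [discrim] at hd
  linarith

/-- Caccioppoli's inequality for `w'' = q`, with a cutoff `χ`. -/
theorem integral_sq_mul_deriv_sq_le {a b : ℝ} (hab : a ≤ b) {w P q χ : ℝ → ℝ}
    (hw : HasACDeriv a b w P) (hP : HasACDeriv a b P q) (hχ : ContDiff ℝ 1 χ)
    (ha : χ a = 0) (hb : χ b = 0) :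
    ∫ u in a..b, (χ u * P u) ^ 2
      ≤ 4 * (∫ u in a..b, (deriv χ u * w u) ^ 2) - 2 * ∫ u in a..b, χ u ^ 2 * (w u * q u) := by
  have hc : HasACDeriv a b χ (deriv χ) := .of_contDiff a b hχ
  have hF := (hc.mul hc).mul (hw.mul hP)
  have i1 : IntervalIntegrable (fun u => χ u ^ 2 * (w u * q u)) volume a b :=
    (hP.intervalIntegrable.continuousOn_mul hw.ac.continuousOn).continuousOn_mul
      (hχ.continuous.pow 2).continuousOn
  have i2 : IntervalIntegrable (fun u => (deriv χ u * w u) ^ 2) volume a b :=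
    (((hχ.continuous_deriv le_rfl).continuousOn.mul hw.ac.continuousOn).pow 2).intervalIntegrable
  have i3 : IntervalIntegrable (fun u => (χ u * P u) ^ 2) volume a b :=
    ((hχ.continuous.continuousOn.mul hP.ac.continuousOn).pow 2).intervalIntegrable
  have hF0 := hF.integral_eq_sub
  simp only [ha, hb, zero_mul, sub_zero] at hF0
  have e : 4 * (∫ u in a..b, (deriv χ u * w u) ^ 2) - 2 * ∫ u in a..b, χ u ^ 2 * (w u * q u)
      = 2 * 0 + (4 * (∫ u in a..b, (deriv χ u * w u) ^ 2)
        - 2 * ∫ u in a..b, χ u ^ 2 * (w u * q u)) := by ring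
  rw [e, ← hF0, ← intervalIntegral.integral_const_mul, ← intervalIntegral.integral_const_mul,
    ← intervalIntegral.integral_const_mul, ← intervalIntegral.integral_sub (i2.const_mul 4)
      (i1.const_mul 2), ← intervalIntegral.integral_add (hF.intervalIntegrable.const_mul 2)
      ((i2.const_mul 4).sub (i1.const_mul 2))]
  refine intervalIntegral.integral_mono_on hab i3 ((hF.intervalIntegrable.const_mul 2).add
    ((i2.const_mul 4).sub (i1.const_mul 2))) fun u _ => ?_
  nlinarith [sq_nonneg (χ u * P u + 2 * (deriv χ u * w u))]

/-- The second derivative is symmetric up to boundary terms. -/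
theorem integral_mul_sub_mul_eq {a b : ℝ} {w₁ P₁ q₁ w₂ P₂ q₂ : ℝ → ℝ}
    (hw₁ : HasACDeriv a b w₁ P₁) (hP₁ : HasACDeriv a b P₁ q₁)
    (hw₂ : HasACDeriv a b w₂ P₂) (hP₂ : HasACDeriv a b P₂ q₂) :
    ∫ u in a..b, (w₁ u * q₂ u - q₁ u * w₂ u)
      = (w₁ b * P₂ b - P₁ b * w₂ b) - (w₁ a * P₂ a - P₁ a * w₂ a) := by
  rw [← ((hw₁.mul hP₂).sub (hP₁.mul hw₂)).integral_eq_sub]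
  congr 1; ext u; ring

/-- With a cutoff `χ` vanishing at the end points, the boundary terms in the symmetry of the second
derivative are replaced by an integral over the region where `χ' ≠ 0`. -/
theorem abs_integral_sq_mul_sub_le {a b D K : ℝ} (hab : a ≤ b) {w₁ P₁ q₁ w₂ P₂ q₂ χ : ℝ → ℝ}
    (hw₁ : HasACDeriv a b w₁ P₁) (hP₁ : HasACDeriv a b P₁ q₁)
    (hw₂ : HasACDeriv a b w₂ P₂) (hP₂ : HasACDeriv a b P₂ q₂) (hχ : ContDiff ℝ 1 χ)
    (ha : χ a = 0) (hb : χ b = 0)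
    (hD₁ : ∫ u in a..b, (deriv χ u * w₁ u) ^ 2 ≤ D) (hD₂ : ∫ u in a..b, (deriv χ u * w₂ u) ^ 2 ≤ D)
    (hK₁ : ∫ u in a..b, (χ u * P₁ u) ^ 2 ≤ K) (hK₂ : ∫ u in a..b, (χ u * P₂ u) ^ 2 ≤ K) :
    |∫ u in a..b, χ u ^ 2 * (w₁ u * q₂ u - q₁ u * w₂ u)| ≤ 4 * (√D * √K) := by
  have hc : HasACDeriv a b χ (deriv χ) := .of_contDiff a b hχ
  have hF := (hc.mul hc).mul ((hw₁.mul hP₂).sub (hP₁.mul hw₂))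
  have hF0 := hF.integral_eq_sub
  simp only [ha, hb, zero_mul, sub_zero] at hF0
  have hχ' := (hχ.continuous_deriv le_rfl).continuousOn (s := uIcc a b)
  have c1 : ∀ {w P}, HasACDeriv a b w P → ContinuousOn (fun u => deriv χ u * w u) (uIcc a b) :=
    fun h => hχ'.mul h.ac.continuousOn
  have c2 : ∀ {P q}, HasACDeriv a b P q → ContinuousOn (fun u => χ u * P u) (uIcc a b) :=
    fun h => hχ.continuous.continuousOn.mul h.ac.continuousOn
  have cs : ∀ {w P P' q}, HasACDeriv a b w P → HasACDeriv a b P' q →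
      ∫ u in a..b, (deriv χ u * w u) ^ 2 ≤ D → ∫ u in a..b, (χ u * P' u) ^ 2 ≤ K →
      |∫ u in a..b, (deriv χ u * w u) * (χ u * P' u)| ≤ √D * √K := fun h h' hD hK =>
    (abs_integral_mul_le_sqrt_mul_sqrt hab ((c1 h).pow 2).intervalIntegrable
      ((c2 h').pow 2).intervalIntegrable ((c1 h).mul (c2 h')).intervalIntegrable).trans
      (mul_le_mul (Real.sqrt_le_sqrt hD) (Real.sqrt_le_sqrt hK) (Real.sqrt_nonneg _)
        (Real.sqrt_nonneg _))
  have i12 : IntervalIntegrable (fun u => (deriv χ u * w₁ u) * (χ u * P₂ u)) volume a b :=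
    ((c1 hw₁).mul (c2 hP₂)).intervalIntegrable
  have i21 : IntervalIntegrable (fun u => (deriv χ u * w₂ u) * (χ u * P₁ u)) volume a b :=
    ((c1 hw₂).mul (c2 hP₁)).intervalIntegrable
  have e : ∫ u in a..b, χ u ^ 2 * (w₁ u * q₂ u - q₁ u * w₂ u)
      = 2 * (∫ u in a..b, (deriv χ u * w₂ u) * (χ u * P₁ u))
        - 2 * ∫ u in a..b, (deriv χ u * w₁ u) * (χ u * P₂ u) := by
    rw [← add_zero (2 * (∫ u in a..b, (deriv χ u * w₂ u) * (χ u * P₁ u)) - _), ← hF0,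
      ← intervalIntegral.integral_const_mul, ← intervalIntegral.integral_const_mul,
      ← intervalIntegral.integral_sub (i21.const_mul 2) (i12.const_mul 2),
      ← intervalIntegral.integral_add ((i21.const_mul 2).sub (i12.const_mul 2))
        hF.intervalIntegrable]
    congr 1; ext u; ring
  rw [e, abs_le]
  have b1 := abs_le.1 (cs hw₁ hP₂ hD₁ hK₂)
  have b2 := abs_le.1 (cs hw₂ hP₁ hD₂ hK₁)
  constructor <;> linarith [b1.1, b1.2, b2.1, b2.2]

/-! ### The time integral of a bounded function -/

/-- The integral over time `∫₀ᵗ r_s(u) ds`. -/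
noncomputable def timeIntegral (r : ℝ → ℝ → ℝ) (t u : ℝ) : ℝ := ∫ s in (0 : ℝ)..t, r s u

section TimeIntegral

variable {r : ℝ → ℝ → ℝ}

theorem measurable_timeIntegral (hr : Measurable (Function.uncurry r)) :
    Measurable (Function.uncurry (timeIntegral r)) := by
  have h : ∀ p q : ℝ × ℝ → ℝ, Measurable p → Measurable q →
      Measurable fun z : ℝ × ℝ => ∫ s in Ioc (p z) (q z), r s z.2 := by
    intro p q hp hq
    have e : ∀ z : ℝ × ℝ, ∫ s in Ioc (p z) (q z), r s z.2
        = ∫ s, ({x : (ℝ × ℝ) × ℝ | p x.1 < x.2 ∧ x.2 ≤ q x.1}.indicator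
            fun x => r x.2 x.1.2) (z, s) := by
      intro z
      rw [← integral_indicator measurableSet_Ioc]
      rfl
    simp_rw [e]
    refine (StronglyMeasurable.integral_prod_right (Measurable.stronglyMeasurable ?_)).measurable
    refine Measurable.indicator
      (hr.comp (measurable_snd.prodMk (measurable_snd.comp measurable_fst))) ?_
    exact (measurableSet_lt (hp.comp measurable_fst) measurable_snd).inter
      (measurableSet_le measurable_snd (hq.comp measurable_fst))
  exact (h _ _ measurable_const measurable_fst).sub (h _ _ measurable_fst measurable_const)

variable (hr : Measurable (Function.uncurry r)) (hb : ∀ s u, |r s u| ≤ 1)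
include hb

theorem abs_timeIntegral_le (t u : ℝ) : |timeIntegral r t u| ≤ |t| := by
  have := intervalIntegral.norm_integral_le_of_norm_le_const (a := 0) (b := t)
    (f := fun s => r s u) (C := 1) fun s _ => hb s u
  simpa [timeIntegral] using this

include hr

theorem intervalIntegrable_slice (u a b : ℝ) : IntervalIntegrable (fun s => r s u) volume a b := by
  refine (intervalIntegrable_const (c := (1 : ℝ))).mono_fun
    (hr.comp (by fun_prop : Measurable fun s : ℝ => (s, u))).aestronglyMeasurable ?_
  exact Eventually.of_forall fun s => by simpa using hb s u

theorem intervalIntegrable_timeIntegral (t a b : ℝ) :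
    IntervalIntegrable (timeIntegral r t) volume a b := by
  refine (intervalIntegrable_const (c := |t|)).mono_fun ((measurable_timeIntegral hr).comp
    (by fun_prop : Measurable fun u : ℝ => (t, u))).aestronglyMeasurable ?_
  exact Eventually.of_forall fun u => by simpa using abs_timeIntegral_le hb t u

theorem hasACDeriv_timeIntegral (t u : ℝ) :
    HasACDeriv 0 t (fun s => timeIntegral r s u) (fun s => r s u) :=
  .of_integral (intervalIntegrable_slice hr hb u 0 t)

theorem timeIntegral_sub_timeIntegral (s t u : ℝ) :
    timeIntegral r t u - timeIntegral r s u = ∫ x in s..t, r x u :=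
  intervalIntegral.integral_interval_sub_left (intervalIntegrable_slice hr hb u 0 t)
    (intervalIntegrable_slice hr hb u 0 s)

/-- The reflection trick: the derivative of `s ↦ W_s W_{2t-s}` integrates to `W_t²` over `[a, t]` if
`W_a = 0`. -/
theorem timeIntegral_sq {a t u : ℝ} (ha : 0 ≤ a) (hat : a ≤ t) (h0 : timeIntegral r a u = 0) :
    timeIntegral r t u ^ 2 = ∫ s in a..t, (r s u * timeIntegral r (2 * t - s) u
      - timeIntegral r s u * r (2 * t - s) u) := by
  have hr' : Measurable (Function.uncurry fun s v => r (2 * t - s) v) :=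
    hr.comp ((measurable_const.sub measurable_fst).prodMk measurable_snd)
  have hsub : uIcc a t ⊆ uIcc 0 t := by
    rw [uIcc_of_le hat, uIcc_of_le (ha.trans hat)]
    exact Icc_subset_Icc_left ha
  have h1 := (hasACDeriv_timeIntegral hr hb t u).mono hsub
  have h2 := (hasACDeriv_timeIntegral hr' (fun s v => hb _ v) t u).mono hsub
  have h3 : HasACDeriv a t (fun _ => timeIntegral r (2 * t) u) (fun _ => 0) := by
    simpa using HasACDeriv.of_contDiff a t (f := fun _ => timeIntegral r (2 * t) u) contDiff_const
  have e : ∀ s, timeIntegral r (2 * t - s) u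
      = timeIntegral r (2 * t) u - timeIntegral (fun s v => r (2 * t - s) v) s u := by
    intro s
    have e1 := timeIntegral_sub_timeIntegral hr hb (2 * t - s) (2 * t) u
    have e2 := intervalIntegral.integral_comp_sub_left (a := 0) (b := s) (fun x => r x u) (2 * t)
    rw [sub_zero] at e2
    rw [show timeIntegral (fun s v => r (2 * t - s) v) s u
      = ∫ x in (0 : ℝ)..s, r (2 * t - x) u from rfl, e2, ← e1]
    ring
  have key := (h1.mul (h3.sub h2)).integral_eq_sub
  simp only [← e, h0, zero_mul, sub_zero, zero_sub] at key
  rw [show 2 * t - t = t by ring, ← sq] at key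
  rw [← key]
  congr 1; ext s; ring

/-- Fubini's theorem for `∫₀ᵗ r_s ds`. -/
theorem integral_timeIntegral_mul {t : ℝ} (ht : 0 ≤ t) {ψ : ℝ → ℝ}
    (hψ : IntegrableOn ψ (Ioc 0 1)) :
    ∫ u in (0 : ℝ)..1, timeIntegral r t u * ψ u
      = ∫ s in (0 : ℝ)..t, ∫ u in (0 : ℝ)..1, r s u * ψ u := by
  simp only [intervalIntegral.integral_of_le ht, intervalIntegral.integral_of_le zero_le_one]
  rw [integral_integral_swap]
  · refine integral_congr_ae (Eventually.of_forall fun u => ?_)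
    simp only [timeIntegral, intervalIntegral.integral_of_le ht, integral_mul_const]
  · refine (hψ.comp_snd (volume.restrict (Ioc 0 t))).bdd_mul (c := 1) hr.aestronglyMeasurable ?_
    exact Eventually.of_forall fun p => by simpa using hb p.1 p.2

/-- If `∫ (r_s W_{s'} - W_s r_{s'}) = 0` in the limit of cutoff functions `χ_n → 1`, then `∫ W_t² = 0`
whenever `W_a = 0` and the reflection of `[a, t]` at `t` stays below `T`. -/
theorem timeIntegral_ae_eq_zero_of_ae_eq_zero {T : ℝ} {χ : ℕ → ℝ → ℝ} {ε : ℕ → ℝ} {p : ℝ → Prop}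
    (hχm : ∀ n, Measurable (χ n)) (hχb : ∀ n u, |χ n u| ≤ 1)
    (hχ : ∀ u ∈ Ioo (0 : ℝ) 1, Tendsto (fun n => χ n u) atTop (𝓝 1))
    (hε : Tendsto ε atTop (𝓝 0)) (hp : ∀ᵐ s, p s)
    (h : ∀ n, ∀ s ∈ Icc 0 T, ∀ s' ∈ Icc 0 T, p s → p s' →
      ∫ u in (0 : ℝ)..1, χ n u * (r s u * timeIntegral r s' u - timeIntegral r s u * r s' u) ≤ ε n)
    {a t : ℝ} (ha : 0 ≤ a) (hat : a ≤ t) (ht : 2 * t - a ≤ T)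
    (h0 : ∀ᵐ u, u ∈ Ioo (0 : ℝ) 1 → timeIntegral r a u = 0) :
    ∀ᵐ u, u ∈ Ioo (0 : ℝ) 1 → timeIntegral r t u = 0 := by
  have hWm := measurable_timeIntegral hr
  have hWt : Measurable (timeIntegral r t) := hWm.comp (by fun_prop : Measurable fun u : ℝ => (t, u))
  have hWb := abs_timeIntegral_le hb
  have hne : ∀ᵐ u : ℝ, u ≠ 1 := by simp [ae_iff]
  have hrefl : Measurable fun p : ℝ × ℝ => (2 * t - p.1, p.2) := by fun_prop
  have hint : ∀ n, Integrable (fun p : ℝ × ℝ => χ n p.2 *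
      (r p.1 p.2 * timeIntegral r (2 * t - p.1) p.2 - timeIntegral r p.1 p.2 * r (2 * t - p.1) p.2))
      ((volume.restrict (Ioc a t)).prod (volume.restrict (Ioc 0 1))) := by
    intro n
    refine Integrable.of_bound (C := T + T) (Measurable.aestronglyMeasurable
      (((hχm n).comp measurable_snd).mul
        ((hr.mul (hWm.comp hrefl)).sub (hWm.mul (hr.comp hrefl))))) ?_
    rw [Measure.prod_restrict, ae_restrict_iff' (measurableSet_Ioc.prod measurableSet_Ioc)]
    refine Eventually.of_forall fun p hp => ?_
    have hp1 := hp.1.1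
    have hp2 := hp.1.2
    have b1 : |timeIntegral r p.1 p.2| ≤ T := by
      refine (hWb _ _).trans ?_
      rw [abs_of_nonneg] <;> linarith
    have b2 : |timeIntegral r (2 * t - p.1) p.2| ≤ T := by
      refine (hWb _ _).trans ?_
      rw [abs_of_nonneg] <;> linarith
    have hT : 0 ≤ T := (abs_nonneg _).trans b1
    rw [Real.norm_eq_abs, abs_mul]
    calc |χ n p.2| * |r p.1 p.2 * timeIntegral r (2 * t - p.1) p.2
            - timeIntegral r p.1 p.2 * r (2 * t - p.1) p.2|
        ≤ 1 * (1 * T + T * 1) := by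
          refine mul_le_mul (hχb n _) ((abs_sub _ _).trans ?_) (abs_nonneg _) zero_le_one
          rw [abs_mul, abs_mul]
          exact add_le_add (mul_le_mul (hb _ _) b2 (abs_nonneg _) zero_le_one)
            (mul_le_mul b1 (hb _ _) (abs_nonneg _) hT)
      _ = T + T := by ring
  have h1 : ∀ n, ∫ u in Ioc (0 : ℝ) 1, χ n u * timeIntegral r t u ^ 2 ≤ (t - a) * ε n := by
    intro n
    have e : ∫ u in Ioc (0 : ℝ) 1, χ n u * timeIntegral r t u ^ 2
        = ∫ s in Ioc a t, ∫ u in Ioc (0 : ℝ) 1, χ n u *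
          (r s u * timeIntegral r (2 * t - s) u - timeIntegral r s u * r (2 * t - s) u) := by
      rw [integral_integral_swap]
      · refine integral_congr_ae ?_
        rw [EventuallyEq, ae_restrict_iff' measurableSet_Ioc]
        filter_upwards [h0, hne] with u hu hu1 hu'
        rw [timeIntegral_sq hr hb ha hat (hu ⟨hu'.1, lt_of_le_of_ne hu'.2 hu1⟩),
          intervalIntegral.integral_of_le hat, integral_const_mul]
      · exact hint n
    have e' : (t - a) * ε n = ∫ s in Ioc a t, ε n := by simp [hat]
    rw [e, e']
    refine integral_mono_ae (hint n).integral_prod_left (by simp) ?_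
    rw [EventuallyLE, ae_restrict_iff' measurableSet_Ioc]
    have hp' : ∀ᵐ s, p (2 * t - s) :=
      (Measure.measurePreserving_sub_left volume (2 * t)).quasiMeasurePreserving.ae hp
    filter_upwards [hp, hp'] with s hs hs1 hs'
    rw [← intervalIntegral.integral_of_le zero_le_one]
    have hs2 := hs'.1
    have hs3 := hs'.2
    exact h n s ⟨by linarith, by linarith⟩ _ ⟨by linarith, by linarith⟩ hs hs1
  have h2 : Tendsto (fun n => ∫ u in Ioc (0 : ℝ) 1, χ n u * timeIntegral r t u ^ 2) atTop
      (𝓝 (∫ u in Ioc (0 : ℝ) 1, timeIntegral r t u ^ 2)) := by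
    refine tendsto_integral_of_dominated_convergence (fun _ => t ^ 2) ?_ (by simp) ?_ ?_
    · exact fun n => ((hχm n).mul (hWt.pow_const 2)).aestronglyMeasurable
    · refine fun n => Eventually.of_forall fun u => ?_
      rw [norm_mul, Real.norm_eq_abs, Real.norm_eq_abs,
        abs_of_nonneg (sq_nonneg (timeIntegral r t u))]
      have := sq_le_sq.2 (hWb t u)
      nlinarith [hχb n u, sq_nonneg (timeIntegral r t u)]
    · rw [ae_restrict_iff' measurableSet_Ioc]
      filter_upwards [hne] with u hu hu'
      simpa using (hχ u ⟨hu'.1, lt_of_le_of_ne hu'.2 hu⟩).mul_const (timeIntegral r t u ^ 2)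
  have h3 : ∫ u in Ioc (0 : ℝ) 1, timeIntegral r t u ^ 2 ≤ 0 := by
    refine le_of_tendsto_of_tendsto' h2 ?_ h1
    simpa using hε.const_mul (t - a)
  have h4 : ∫ u in Ioc (0 : ℝ) 1, timeIntegral r t u ^ 2 = 0 :=
    le_antisymm h3 (integral_nonneg fun u => sq_nonneg _)
  have h5 : IntegrableOn (fun u => timeIntegral r t u ^ 2) (Ioc 0 1) :=
    Integrable.of_bound (C := t ^ 2) (hWt.pow_const 2).aestronglyMeasurable
      (Eventually.of_forall fun u => by
        simpa [Real.norm_eq_abs] using sq_le_sq.2 (hWb t u))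
  rw [integral_eq_zero_iff_of_nonneg (fun u => sq_nonneg _) h5] at h4
  filter_upwards [(ae_restrict_iff' measurableSet_Ioc).1 h4] with u hu hu'
  simpa using hu (Ioo_subset_Ioc_self hu')

/-- Symmetry of the evolution forces its solution `W` with `W_0 = 0` to vanish. -/
theorem timeIntegral_ae_eq_zero {T : ℝ} {χ : ℕ → ℝ → ℝ} {ε : ℕ → ℝ} {p : ℝ → Prop}
    (hχm : ∀ n, Measurable (χ n)) (hχb : ∀ n u, |χ n u| ≤ 1)
    (hχ : ∀ u ∈ Ioo (0 : ℝ) 1, Tendsto (fun n => χ n u) atTop (𝓝 1))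
    (hε : Tendsto ε atTop (𝓝 0)) (hp : ∀ᵐ s, p s)
    (h : ∀ n, ∀ s ∈ Icc 0 T, ∀ s' ∈ Icc 0 T, p s → p s' →
      ∫ u in (0 : ℝ)..1, χ n u * (r s u * timeIntegral r s' u - timeIntegral r s u * r s' u) ≤ ε n)
    {t : ℝ} (ht : t ∈ Icc 0 T) : ∀ᵐ u, u ∈ Ioo (0 : ℝ) 1 → timeIntegral r t u = 0 := by
  have hT : 0 ≤ T := ht.1.trans ht.2
  -- Each step of the induction halves the distance to `T`.
  have hn : ∀ n : ℕ, ∀ t, 0 ≤ t → t ≤ T * (1 - (1 / 2) ^ n) →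
      ∀ᵐ u, u ∈ Ioo (0 : ℝ) 1 → timeIntegral r t u = 0 := by
    intro n
    induction n with
    | zero =>
      intro t h1 h2
      have : t = 0 := by
        rw [pow_zero, sub_self, mul_zero] at h2
        exact le_antisymm h2 h1
      exact Eventually.of_forall fun u _ => by simp [this, timeIntegral]
    | succ n ih =>
      intro t h1 h2
      have ha : 0 ≤ T * (1 - (1 / 2) ^ n) :=
        mul_nonneg hT (sub_nonneg.2 (pow_le_one₀ (by norm_num) (by norm_num)))
      rcases le_total t (T * (1 - (1 / 2) ^ n)) with h3 | h3
      · exact ih t h1 h3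
      · refine timeIntegral_ae_eq_zero_of_ae_eq_zero hr hb hχm hχb hχ hε hp h ha h3 ?_
          (ih _ ha le_rfl)
        rw [pow_succ] at h2
        linarith
  -- The end point `T` itself is reached by continuity.
  have hlim : Tendsto (fun n : ℕ => t * (1 / 2 : ℝ) ^ n) atTop (𝓝 0) := by
    simpa using (tendsto_pow_atTop_nhds_zero_of_lt_one (r := (1 / 2 : ℝ)) (by norm_num)
      (by norm_num)).const_mul t
  have hall := ae_all_iff.2 fun n : ℕ => hn n (t * (1 - (1 / 2) ^ n))
    (mul_nonneg ht.1 (sub_nonneg.2 (pow_le_one₀ (by norm_num) (by norm_num))))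
    (mul_le_mul_of_nonneg_right ht.2 (sub_nonneg.2 (pow_le_one₀ (by norm_num) (by norm_num))))
  filter_upwards [hall] with u hu hu'
  have hle : ∀ n : ℕ, |timeIntegral r t u| ≤ t * (1 / 2 : ℝ) ^ n := by
    intro n
    have e := timeIntegral_sub_timeIntegral hr hb (t * (1 - (1 / 2) ^ n)) t u
    rw [hu n hu', sub_zero] at e
    rw [e]
    have := intervalIntegral.norm_integral_le_of_norm_le_const (a := t * (1 - (1 / 2) ^ n)) (b := t)
      (f := fun s => r s u) (C := 1) fun s _ => hb s u
    rw [Real.norm_eq_abs, one_mul] at this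
    refine this.trans (le_of_eq ?_)
    rw [show t - t * (1 - (1 / 2) ^ n) = t * (1 / 2) ^ n by ring]
    exact abs_of_nonneg (mul_nonneg ht.1 (by positivity))
  exact abs_nonpos_iff.1 (ge_of_tendsto' hlim hle)

end TimeIntegral

/-! ### The equation for the difference of two densities -/

section ConstantTest

variable {T : ℝ} {φ : ℝ → ℝ}

theorem du_const_eq (hφ : ContDiff ℝ 2 φ) (t : ℝ) {u : ℝ} (hu : u ∈ Icc (0 : ℝ) 1) :
    du (fun _ => φ) t u = deriv φ u :=
  (hφ.differentiable two_ne_zero u).derivWithin (uniqueDiffOn_Icc zero_lt_one u hu)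

theorem duu_const_eq (hφ : ContDiff ℝ 2 φ) (t : ℝ) {u : ℝ} (hu : u ∈ Icc (0 : ℝ) 1) :
    duu (fun _ => φ) t u = deriv (deriv φ) u := by
  have h2 : ContDiff ℝ 1 (deriv φ) := ((contDiff_succ_iff_deriv (n := 1)).1 hφ).2.2
  rw [duu, du, derivWithin_congr (fun v hv => du_const_eq hφ t hv) (du_const_eq hφ t hu)]
  exact (h2.differentiable one_ne_zero u).derivWithin (uniqueDiffOn_Icc zero_lt_one u hu)

theorem dt_const_eq (t u : ℝ) : dt T (fun _ => φ) t u = 0 := by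
  simp [dt]

theorem c12_const (T : ℝ) (hφ : ContDiff ℝ 2 φ) : C12 T (fun _ => φ) := by
  have h1 : ContDiff ℝ 1 φ := hφ.of_le (by norm_num)
  have h2 : ContDiff ℝ 1 (deriv φ) := ((contDiff_succ_iff_deriv (n := 1)).1 hφ).2.2
  have h3 : Continuous (deriv (deriv φ)) := h2.continuous_deriv le_rfl
  refine ⟨fun u _ => differentiableOn_const _,
    fun t _ => (h1.differentiable one_ne_zero).differentiableOn, fun t _ => ?_, ?_, ?_, ?_, ?_⟩
  · exact (h2.differentiable one_ne_zero).differentiableOn.congr fun u hu => du_const_eq hφ t hu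
  · exact (h1.continuous.comp continuous_snd).continuousOn
  · simp only [dt_const_eq]
    exact continuousOn_const
  · exact (h2.continuous.comp continuous_snd).continuousOn.congr
      fun p hp => du_const_eq hφ p.1 hp.2
  · exact (h3.comp continuous_snd).continuousOn.congr fun p hp => duu_const_eq hφ p.1 hp.2

theorem heatFunctional_const (c : ℝ) (ρ : ℝ → ℝ → ℝ) (g : ℝ → ℝ) (hφ : ContDiff ℝ 2 φ) (t : ℝ) :
    heatFunctional T c ρ g (fun _ => φ) t
      = pair (ρ t) φ - pair g φ
        - ∫ s in (0 : ℝ)..t, pair (ρ s) (fun u => c * deriv (deriv φ) u) := by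
  unfold heatFunctional pair
  congr 1
  refine intervalIntegral.integral_congr fun s _ => intervalIntegral.integral_congr fun u hu => ?_
  rw [uIcc_of_le zero_le_one] at hu
  simp only [dt_const_eq, duu_const_eq hφ s hu, zero_add]

end ConstantTest

section Density

variable {T : ℝ} {φ : ℝ → ℝ} {ρ ρ₁ ρ₂ : ℝ → ℝ → ℝ}

theorem IsDensity.intervalIntegrable_pair (hρ : IsDensity T ρ) {ψ : ℝ → ℝ}
    (hψ : IntegrableOn ψ (Ioc 0 1)) {t : ℝ} (ht : t ∈ Icc 0 T) :
    IntervalIntegrable (fun s => pair (ρ s) ψ) volume 0 t := by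
  rw [intervalIntegrable_iff_integrableOn_Ioc_of_le ht.1]
  simp only [pair, intervalIntegral.integral_of_le zero_le_one]
  have hsub : Ioc 0 t ×ˢ Ioc 0 1 ⊆ Icc 0 T ×ˢ Icc (0 : ℝ) 1 :=
    prod_mono (Ioc_subset_Icc_self.trans (Icc_subset_Icc_right ht.2)) Ioc_subset_Icc_self
  have h : Integrable (fun p : ℝ × ℝ => ρ p.1 p.2 * ψ p.2)
      ((volume.restrict (Ioc 0 t)).prod (volume.restrict (Ioc 0 1))) := by
    refine (hψ.comp_snd (volume.restrict (Ioc 0 t))).bdd_mul (c := 1) ?_ ?_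
    · rw [Measure.prod_restrict]
      exact (hρ.meas.mono_measure (Measure.restrict_mono_set _ hsub)).aestronglyMeasurable
    · rw [Measure.prod_restrict, ae_restrict_iff' (measurableSet_Ioc.prod measurableSet_Ioc)]
      refine Eventually.of_forall fun p hp => ?_
      have := hρ.mem p.1 (hsub hp).1 p.2 (hsub hp).2
      rw [Real.norm_eq_abs, abs_of_nonneg this.1]
      exact this.2
  exact h.integral_prod_left

theorem IsDensity.intervalIntegrable_mul (hρ : IsDensity T ρ) {ψ : ℝ → ℝ}
    (hψ : IntegrableOn ψ (Ioc 0 1)) {t : ℝ} (ht : t ∈ Icc 0 T) :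
    IntervalIntegrable (fun u => ρ t u * ψ u) volume 0 1 := by
  rw [intervalIntegrable_iff_integrableOn_Ioc_of_le zero_le_one]
  refine hψ.bdd_mul (c := 1) ((hρ.meas_slice t ht).mono_measure
    (Measure.restrict_mono_set _ Ioc_subset_Icc_self)).aestronglyMeasurable ?_
  rw [ae_restrict_iff' measurableSet_Ioc]
  refine Eventually.of_forall fun u hu => ?_
  have := hρ.mem t ht u (Ioc_subset_Icc_self hu)
  rw [Real.norm_eq_abs, abs_of_nonneg this.1]
  exact this.2

theorem IsDensity.intervalIntegrable_slice (hρ : IsDensity T ρ) {t : ℝ} (ht : t ∈ Icc 0 T) :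
    IntervalIntegrable (ρ t) volume 0 1 := by
  simpa using hρ.intervalIntegrable_mul (ψ := fun _ => 1) (by simp) ht

/-- The difference of two densities has a bounded Borel measurable version. -/
theorem IsDensity.exists_measurable_sub (h₁ : IsDensity T ρ₁) (h₂ : IsDensity T ρ₂) :
    ∃ r : ℝ → ℝ → ℝ, Measurable (Function.uncurry r) ∧ (∀ s u, |r s u| ≤ 1) ∧
      (∀ᵐ s, s ∈ Icc 0 T → ∀ᵐ u, u ∈ Icc (0 : ℝ) 1 → r s u = ρ₁ s u - ρ₂ s u) ∧
      ∀ᵐ p ∂((volume.restrict (Icc 0 T)).prod (volume.restrict (Icc (0 : ℝ) 1))),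
        r p.1 p.2 = ρ₁ p.1 p.2 - ρ₂ p.1 p.2 := by
  obtain ⟨f, hf, hae⟩ := h₁.meas.sub h₂.meas
  have clamp : ∀ s ∈ Icc 0 T, ∀ u ∈ Icc (0 : ℝ) 1, ρ₁ s u - ρ₂ s u = f (s, u) →
      max (-1) (min 1 (f (s, u))) = ρ₁ s u - ρ₂ s u := by
    intro s hs u hu e
    have m1 := h₁.mem s hs u hu
    have m2 := h₂.mem s hs u hu
    rw [← e, min_eq_right (by linarith [m1.2, m2.1]), max_eq_right (by linarith [m1.1, m2.2])]
  refine ⟨fun s u => max (-1) (min 1 (f (s, u))), ?_, fun s u => ?_, ?_, ?_⟩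
  · exact measurable_const.max (measurable_const.min hf)
  · rw [abs_le]
    exact ⟨le_max_left _ _, max_le (by norm_num) (min_le_left _ _)⟩
  · rw [Measure.volume_eq_prod, ← Measure.prod_restrict] at hae
    have h := Measure.ae_ae_of_ae_prod hae
    rw [ae_restrict_iff' measurableSet_Icc] at h
    filter_upwards [h] with s hs hs'
    have hs2 := hs hs'
    rw [ae_restrict_iff' measurableSet_Icc] at hs2
    filter_upwards [hs2] with u hu hu'
    exact clamp s hs' u hu' (hu hu')
  · rw [Measure.prod_restrict, ← Measure.volume_eq_prod,
      ae_restrict_iff' (measurableSet_Icc.prod measurableSet_Icc)]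
    rw [EventuallyEq, ae_restrict_iff' (measurableSet_Icc.prod measurableSet_Icc)] at hae
    filter_upwards [hae] with p hp hp'
    exact clamp p.1 hp'.1 p.2 hp'.2 (hp hp')

variable {r : ℝ → ℝ → ℝ} (h₁ : IsDensity T ρ₁) (h₂ : IsDensity T ρ₂)
  (hr : Measurable (Function.uncurry r)) (hb : ∀ s u, |r s u| ≤ 1)
  (hrρ : ∀ᵐ s, s ∈ Icc 0 T → ∀ᵐ u, u ∈ Icc (0 : ℝ) 1 → r s u = ρ₁ s u - ρ₂ s u)
include h₁ h₂ hr hb hrρ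

theorem integral_pair_sub_integral_pair {ψ : ℝ → ℝ} (hψ : IntegrableOn ψ (Ioc 0 1)) {t : ℝ}
    (ht : t ∈ Icc 0 T) :
    (∫ s in (0 : ℝ)..t, pair (ρ₁ s) ψ) - ∫ s in (0 : ℝ)..t, pair (ρ₂ s) ψ
      = ∫ u in (0 : ℝ)..1, timeIntegral r t u * ψ u := by
  rw [integral_timeIntegral_mul hr hb ht.1 hψ, ← intervalIntegral.integral_sub
    (h₁.intervalIntegrable_pair hψ ht) (h₂.intervalIntegrable_pair hψ ht)]
  refine intervalIntegral.integral_congr_ae ?_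
  filter_upwards [hrρ] with s hs hs'
  rw [uIoc_of_le ht.1] at hs'
  have hsT : s ∈ Icc 0 T := ⟨hs'.1.le, hs'.2.trans ht.2⟩
  rw [pair, pair, ← intervalIntegral.integral_sub (h₁.intervalIntegrable_mul hψ hsT)
    (h₂.intervalIntegrable_mul hψ hsT)]
  refine intervalIntegral.integral_congr_ae ?_
  filter_upwards [hs hsT] with u hu hu'
  rw [uIoc_of_le zero_le_one] at hu'
  rw [hu (Ioc_subset_Icc_self hu')]
  ring

/-- The equation for the difference of two solutions, integrated in time, for test functions that do
not depend on time. -/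
theorem heatFunctional_sub_heatFunctional (c : ℝ) (g : ℝ → ℝ) (hφ : ContDiff ℝ 2 φ) {t : ℝ}
    (ht : t ∈ Icc 0 T) :
    heatFunctional T c ρ₁ g (fun _ => φ) t - heatFunctional T c ρ₂ g (fun _ => φ) t
      = (∫ u in (0 : ℝ)..1, (ρ₁ t u - ρ₂ t u) * φ u)
        - c * ∫ u in (0 : ℝ)..1, timeIntegral r t u * deriv (deriv φ) u := by
  have h2 : ContDiff ℝ 1 (deriv φ) := ((contDiff_succ_iff_deriv (n := 1)).1 hφ).2.2
  have h3 : Continuous (deriv (deriv φ)) := h2.continuous_deriv le_rfl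
  have i0 : IntegrableOn φ (Ioc 0 1) := hφ.continuous.integrableOn_Ioc
  have i2 : IntegrableOn (fun u => c * deriv (deriv φ) u) (Ioc 0 1) :=
    (continuous_const.mul h3).integrableOn_Ioc
  have e := integral_pair_sub_integral_pair h₁ h₂ hr hb hrρ i2 ht
  have e1 : ∫ u in (0 : ℝ)..1, (ρ₁ t u - ρ₂ t u) * φ u = pair (ρ₁ t) φ - pair (ρ₂ t) φ := by
    rw [pair, pair, ← intervalIntegral.integral_sub (h₁.intervalIntegrable_mul i0 ht)
      (h₂.intervalIntegrable_mul i0 ht)]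
    congr 1; ext u; ring
  have e2 : c * ∫ u in (0 : ℝ)..1, timeIntegral r t u * deriv (deriv φ) u
      = ∫ u in (0 : ℝ)..1, timeIntegral r t u * (c * deriv (deriv φ) u) := by
    rw [← intervalIntegral.integral_const_mul]
    congr 1; ext u; ring
  rw [heatFunctional_const c ρ₁ g hφ, heatFunctional_const c ρ₂ g hφ, e1, e2, ← e]
  ring

end Density

/-! ### Robin and Neumann boundary conditions -/

section Robin

variable {T c k : ℝ} {φ : ℝ → ℝ} {r d : ℝ → ℝ → ℝ}

/-- If `c W'' = f` weakly with homogeneous Robin conditions, then `W` is regular and obeys the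
boundary conditions `W' = k W` at `0` and `W' = - k W` at `1`. -/
theorem exists_hasACDeriv_of_robin (hc : 0 < c) {W f : ℝ → ℝ}
    (hW : IntervalIntegrable W volume 0 1) (hf : IntervalIntegrable f volume 0 1)
    (h : ∀ φ : ℝ → ℝ, ContDiff ℝ 2 φ → deriv φ 0 = k * φ 0 → deriv φ 1 = - (k * φ 1) →
      ∫ u in (0 : ℝ)..1, f u * φ u = c * ∫ u in (0 : ℝ)..1, W u * deriv (deriv φ) u) :
    ∃ w P, HasACDeriv 0 1 w P ∧ HasACDeriv 0 1 P (fun u => c⁻¹ * f u) ∧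
      (∀ᵐ u, u ∈ uIoc (0 : ℝ) 1 → W u = w u) ∧ P 0 = k * w 0 ∧ P 1 = - (k * w 1) := by
  have h' : ∀ φ : ℝ → ℝ, ContDiff ℝ 2 φ → deriv φ 0 = k * φ 0 → deriv φ 1 = - (k * φ 1) →
      ∫ u in (0 : ℝ)..1, W u * deriv (deriv φ) u = ∫ u in (0 : ℝ)..1, (c⁻¹ * f u) * φ u := by
    intro φ h1 h2 h3
    simp_rw [mul_assoc, intervalIntegral.integral_const_mul, h φ h1 h2 h3]
    field_simp
  obtain ⟨w, P, hw, hP, hWw⟩ := exists_hasACDeriv_of_forall_integral_eq zero_lt_one hW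
    (hf.const_mul c⁻¹) (fun φ h1 h2 h3 => by
      have z : ∀ u, u ∉ Ioo (0 : ℝ) 1 → φ u = 0 := fun u hu =>
        image_eq_zero_of_notMem_tsupport fun h => hu (h3 h)
      have z' : ∀ u, u ∉ Ioo (0 : ℝ) 1 → deriv φ u = 0 := fun u hu =>
        image_eq_zero_of_notMem_tsupport fun h => hu (h3 (tsupport_deriv_subset h))
      exact h' φ (contDiff_infty.1 h1 2) (by rw [z 0 (by simp), z' 0 (by simp), mul_zero])
        (by rw [z 1 (by simp), z' 1 (by simp), mul_zero, neg_zero]))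
  have green : ∀ φ : ℝ → ℝ, ContDiff ℝ 2 φ → deriv φ 0 = k * φ 0 → deriv φ 1 = - (k * φ 1) →
      (w 1 * deriv φ 1 - P 1 * φ 1) - (w 0 * deriv φ 0 - P 0 * φ 0) = 0 := by
    intro φ h1 h2 h3
    rw [← integral_mul_deriv_deriv_sub_integral_mul hw hP h1, ← h' φ h1 h2 h3, sub_eq_zero]
    refine intervalIntegral.integral_congr_ae ?_
    filter_upwards [hWw] with u hu hu'
    rw [hu hu']
  -- Cubic test functions that see only one end point give the boundary conditions for `w`.
  refine ⟨w, P, hw, hP, hWw, ?_, ?_⟩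
  · have hd : ∀ u, HasDerivAt (fun u : ℝ => (1 - u) ^ 2 * (1 + (2 + k) * u))
        (-2 * (1 - u) * (1 + (2 + k) * u) + (1 - u) ^ 2 * (2 + k)) u := by
      intro u
      have e1 : HasDerivAt (fun u : ℝ => (1 - u) ^ 2) (-2 * (1 - u)) u := by
        refine (((hasDerivAt_id u).const_sub 1).pow 2).congr_deriv ?_
        norm_num
      have e2 : HasDerivAt (fun u : ℝ => 1 + (2 + k) * u) (2 + k) u := by
        simpa using ((hasDerivAt_id u).const_mul (2 + k)).const_add 1
      exact e1.mul e2
    have := green (fun u => (1 - u) ^ 2 * (1 + (2 + k) * u)) (by fun_prop)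
      (by rw [(hd 0).deriv]; ring) (by rw [(hd 1).deriv]; ring)
    rw [(hd 0).deriv, (hd 1).deriv] at this
    linarith
  · have hd : ∀ u, HasDerivAt (fun u : ℝ => u ^ 2 * (1 + (2 + k) * (1 - u)))
        (2 * u * (1 + (2 + k) * (1 - u)) + u ^ 2 * (- (2 + k))) u := by
      intro u
      have e1 : HasDerivAt (fun u : ℝ => u ^ 2) (2 * u) u := by
        simpa using hasDerivAt_pow 2 u
      have e2 : HasDerivAt (fun u : ℝ => 1 + (2 + k) * (1 - u)) (- (2 + k)) u := by
        simpa using (((hasDerivAt_id u).const_sub 1).const_mul (2 + k)).const_add 1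
      exact e1.mul e2
    have := green (fun u => u ^ 2 * (1 + (2 + k) * (1 - u))) (by fun_prop)
      (by rw [(hd 0).deriv]; ring) (by rw [(hd 1).deriv]; ring)
    rw [(hd 0).deriv, (hd 1).deriv] at this
    linarith

/-- Symmetry of the Laplacian with homogeneous Robin conditions. -/
theorem integral_mul_sub_mul_eq_zero_of_robin (hc : 0 < c) {W₁ f₁ W₂ f₂ : ℝ → ℝ}
    (hW₁ : IntervalIntegrable W₁ volume 0 1) (hf₁ : IntervalIntegrable f₁ volume 0 1)
    (hW₂ : IntervalIntegrable W₂ volume 0 1) (hf₂ : IntervalIntegrable f₂ volume 0 1)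
    (h₁ : ∀ φ : ℝ → ℝ, ContDiff ℝ 2 φ → deriv φ 0 = k * φ 0 → deriv φ 1 = - (k * φ 1) →
      ∫ u in (0 : ℝ)..1, f₁ u * φ u = c * ∫ u in (0 : ℝ)..1, W₁ u * deriv (deriv φ) u)
    (h₂ : ∀ φ : ℝ → ℝ, ContDiff ℝ 2 φ → deriv φ 0 = k * φ 0 → deriv φ 1 = - (k * φ 1) →
      ∫ u in (0 : ℝ)..1, f₂ u * φ u = c * ∫ u in (0 : ℝ)..1, W₂ u * deriv (deriv φ) u) :
    ∫ u in (0 : ℝ)..1, (f₁ u * W₂ u - W₁ u * f₂ u) = 0 := by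
  obtain ⟨w₁, P₁, hw₁, hP₁, e₁, a₁, b₁⟩ := exists_hasACDeriv_of_robin hc hW₁ hf₁ h₁
  obtain ⟨w₂, P₂, hw₂, hP₂, e₂, a₂, b₂⟩ := exists_hasACDeriv_of_robin hc hW₂ hf₂ h₂
  have e : ∫ u in (0 : ℝ)..1, (f₁ u * W₂ u - W₁ u * f₂ u)
      = -c * ∫ u in (0 : ℝ)..1, (w₁ u * (c⁻¹ * f₂ u) - c⁻¹ * f₁ u * w₂ u) := by
    rw [← intervalIntegral.integral_const_mul]
    refine intervalIntegral.integral_congr_ae ?_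
    filter_upwards [e₁, e₂] with u h1 h2 hu
    rw [h1 hu, h2 hu]
    field_simp
    ring
  rw [e, integral_mul_sub_mul_eq hw₁ hP₁ hw₂ hP₂, a₁, b₁, a₂, b₂]
  ring

/-- Uniqueness for the homogeneous Robin problem, with `d` the solution and `r` a version of it that
is jointly measurable. -/
theorem ae_eq_zero_of_robin (hc : 0 < c) (hr : Measurable (Function.uncurry r))
    (hb : ∀ s u, |r s u| ≤ 1) (hd : ∀ t ∈ Icc 0 T, IntervalIntegrable (d t) volume 0 1)
    (hrd : ∀ᵐ s, s ∈ Icc 0 T → ∀ᵐ u, u ∈ Icc (0 : ℝ) 1 → r s u = d s u)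
    (h : ∀ t ∈ Icc 0 T, ∀ φ : ℝ → ℝ, ContDiff ℝ 2 φ → deriv φ 0 = k * φ 0 →
      deriv φ 1 = - (k * φ 1) → ∫ u in (0 : ℝ)..1, d t u * φ u
        = c * ∫ u in (0 : ℝ)..1, timeIntegral r t u * deriv (deriv φ) u)
    {t : ℝ} (ht : t ∈ Icc 0 T) : ∀ᵐ u, u ∈ Ioo (0 : ℝ) 1 → d t u = 0 := by
  have hW := timeIntegral_ae_eq_zero hr hb (T := T) (χ := fun _ _ => 1) (ε := fun _ => 0)
    (fun _ => measurable_const) (by simp) (fun _ _ => tendsto_const_nhds) tendsto_const_nhds hrd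
    (fun _ s hsT s' hsT' hs hs' => by
      have e := integral_mul_sub_mul_eq_zero_of_robin hc
        (intervalIntegrable_timeIntegral hr hb s 0 1) (hd s hsT)
        (intervalIntegrable_timeIntegral hr hb s' 0 1) (hd s' hsT') (h s hsT) (h s' hsT')
      refine le_of_eq ((intervalIntegral.integral_congr_ae ?_).trans e)
      filter_upwards [hs hsT, hs' hsT'] with u hu hu1 hu'
      rw [uIoc_of_le zero_le_one] at hu'
      rw [hu (Ioc_subset_Icc_self hu'), hu1 (Ioc_subset_Icc_self hu'), one_mul]) ht
  refine ae_eq_zero_of_forall_integral_mul_eq_zero zero_lt_one (hd t ht) fun φ h1 h2 h3 => ?_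
  have z : ∀ u, u ∉ Ioo (0 : ℝ) 1 → φ u = 0 := fun u hu =>
    image_eq_zero_of_notMem_tsupport fun h => hu (h3 h)
  have z' : ∀ u, u ∉ Ioo (0 : ℝ) 1 → deriv φ u = 0 := fun u hu =>
    image_eq_zero_of_notMem_tsupport fun h => hu (h3 (tsupport_deriv_subset h))
  rw [h t ht φ (contDiff_infty.1 h1 2) (by rw [z 0 (by simp), z' 0 (by simp), mul_zero])
    (by rw [z 1 (by simp), z' 1 (by simp), mul_zero, neg_zero])]
  rw [intervalIntegral.integral_zero_ae, mul_zero]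
  filter_upwards [ae_mem_uIoc_of_ae_mem_Ioo zero_le_one hW] with u hu hu'
  rw [hu hu', zero_mul]

theorem ae_restrict_Icc_eq_of_sub_eq_zero {f g : ℝ → ℝ}
    (h : ∀ᵐ u, u ∈ Ioo (0 : ℝ) 1 → f u - g u = 0) : f =ᵐ[volume.restrict (Icc 0 1)] g := by
  rw [← Measure.restrict_congr_set Ioo_ae_eq_Icc]
  rw [EventuallyEq, ae_restrict_iff' measurableSet_Ioo]
  filter_upwards [h] with u hu hu'
  exact sub_eq_zero.1 (hu hu')

variable {m α β : ℝ} {g : ℝ → ℝ} {ρ₁ ρ₂ : ℝ → ℝ → ℝ}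

theorem robinTest_const (hφ : ContDiff ℝ 2 φ) (h0 : deriv φ 0 = m / c * (φ 0 - α))
    (h1 : deriv φ 1 = m / c * (β - φ 1)) : RobinTest T m c α β (fun _ => φ) :=
  ⟨c12_const T hφ, fun t _ => by rw [du_const_eq hφ t (by simp), h1],
    fun t _ => by rw [du_const_eq hφ t (by simp), h0]⟩

theorem IsWeakSolRobinHom.ae_eq (hc : 0 < c)
    (h₁ : IsWeakSolRobinHom T c m α β g ρ₁) (h₂ : IsWeakSolRobinHom T c m α β g ρ₂)
    {t : ℝ} (ht : t ∈ Icc 0 T) : ρ₁ t =ᵐ[volume.restrict (Icc 0 1)] ρ₂ t := by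
  obtain ⟨r, hr, hb, hrρ, -⟩ := h₁.density.exists_measurable_sub h₂.density
  refine ae_restrict_Icc_eq_of_sub_eq_zero (ae_eq_zero_of_robin (k := m / c)
    (d := fun t u => ρ₁ t u - ρ₂ t u) hc hr hb
    (fun t ht => (h₁.density.intervalIntegrable_slice ht).sub
      (h₂.density.intervalIntegrable_slice ht)) hrρ (fun t ht φ hφ h0 h1 => ?_) ht)
  have hG : RobinTest T m c 0 0 (fun _ => φ) :=
    robinTest_const hφ (by rw [h0, sub_zero]) (by rw [h1]; ring)
  have e := heatFunctional_sub_heatFunctional h₁.density h₂.density hr hb hrρ c g hφ ht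
  have e₁ := h₁.weak t ht _ hG
  have e₂ := h₂.weak t ht _ hG
  linarith

/-- The affine stationary solution is itself a test function, and its sum with a function obeying
the homogeneous conditions is one. -/
theorem IsWeakSolRobin.ae_eq (hc : 0 < c) (hm : 0 ≤ m)
    (h₁ : IsWeakSolRobin T c m α β g ρ₁) (h₂ : IsWeakSolRobin T c m α β g ρ₂)
    {t : ℝ} (ht : t ∈ Icc 0 T) : ρ₁ t =ᵐ[volume.restrict (Icc 0 1)] ρ₂ t := by
  obtain ⟨r, hr, hb, hrρ, -⟩ := h₁.density.exists_measurable_sub h₂.density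
  refine ae_restrict_Icc_eq_of_sub_eq_zero (ae_eq_zero_of_robin (k := m / c)
    (d := fun t u => ρ₁ t u - ρ₂ t u) hc hr hb
    (fun t ht => (h₁.density.intervalIntegrable_slice ht).sub
      (h₂.density.intervalIntegrable_slice ht)) hrρ (fun t ht φ hφ h0 h1 => ?_) ht)
  have hmc : m + 2 * c ≠ 0 := by positivity
  set A := α + c * (β - α) / (m + 2 * c) with hA
  set B := m * (β - α) / (m + 2 * c) with hB
  have key : ∀ ψ : ℝ → ℝ, ContDiff ℝ 2 ψ → deriv ψ 0 = m / c * (ψ 0 - α) →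
      deriv ψ 1 = m / c * (β - ψ 1) → ∫ u in (0 : ℝ)..1, (ρ₁ t u - ρ₂ t u) * ψ u
        = c * ∫ u in (0 : ℝ)..1, timeIntegral r t u * deriv (deriv ψ) u := by
    intro ψ hψ k0 k1
    have hG : RobinTest T m c α β (fun _ => ψ) := robinTest_const hψ k0 k1
    have e := heatFunctional_sub_heatFunctional h₁.density h₂.density hr hb hrρ c g hψ ht
    rw [h₁.weak t ht _ hG, h₂.weak t ht _ hG] at e
    linarith
  have dA : deriv (fun u : ℝ => A + B * u) = fun _ => B := by
    ext u; simp
  have dφ : deriv (fun u : ℝ => (A + B * u) + φ u) = fun u => B + deriv φ u := by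
    ext u
    have := (hφ.differentiable two_ne_zero u).hasDerivAt
    have h2 : HasDerivAt (fun u : ℝ => A + B * u) B u := by
      simpa using ((hasDerivAt_id u).const_mul B).const_add A
    exact (h2.add this).deriv
  have ddφ : deriv (fun u => B + deriv φ u) = deriv (deriv φ) := by
    ext u; simp
  have B0 : B = m / c * (A - α) := by
    rw [hA, hB]; field_simp; ring
  have B1 : B = m / c * (β - (A + B)) := by
    rw [hA, hB]; field_simp; ring
  have k1 := key (fun u => A + B * u) (by fun_prop) (by rw [dA]; simpa using B0)
    (by rw [dA]; simpa using B1)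
  have k2 := key (fun u => (A + B * u) + φ u) (by fun_prop)
    (by rw [dφ]; simp only [h0, mul_zero, add_zero]; linear_combination B0)
    (by rw [dφ]; simp only [h1, mul_one]; linear_combination B1)
  rw [dφ, ddφ] at k2
  rw [dA] at k1
  simp only [deriv_const', mul_zero, intervalIntegral.integral_zero] at k1
  rw [← k2]
  have id := (h₁.density.intervalIntegrable_slice ht).sub (h₂.density.intervalIntegrable_slice ht)
  have e : ∫ u in (0 : ℝ)..1, (ρ₁ t u - ρ₂ t u) * ((A + B * u) + φ u)
      = (∫ u in (0 : ℝ)..1, (ρ₁ t u - ρ₂ t u) * (A + B * u))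
        + ∫ u in (0 : ℝ)..1, (ρ₁ t u - ρ₂ t u) * φ u := by
    rw [← intervalIntegral.integral_add
      (id.mul_continuousOn (g := fun u => A + B * u) (by fun_prop))
      (id.mul_continuousOn hφ.continuous.continuousOn)]
    congr 1; ext u; ring
  rw [e, k1, zero_add]

end Robin

/-! ### Interior cutoffs and the reaction–diffusion operator -/

section Reaction

/-- If `f = c W'' + V W` weakly on `(0, 1)` with `c > 0` and a potential `V` that is continuous on the
open interval, then `W` is regular in the interior. For a cutoff `χ` supported in `[a, b]`, the
energy `∫ (χ W')²` is controlled by an integrable majorant `Z` of `W²`. -/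
theorem exists_hasACDeriv_of_reaction {c a b : ℝ} (hc : 0 < c) (ha : 0 < a) (hab : a < b)
    (hb : b < 1) {W f V Z χ : ℝ → ℝ} (hW : IntervalIntegrable W volume 0 1)
    (hf : IntervalIntegrable f volume 0 1) (hf1 : ∀ u ∈ Ioo (0 : ℝ) 1, |f u| ≤ 1)
    (hV : ContinuousOn V (Ioo 0 1)) (hV0 : ∀ u ∈ Ioo (0 : ℝ) 1, 0 ≤ V u)
    (hWZ : ∀ u, W u ^ 2 ≤ Z u) (hZ : IntegrableOn Z (Ioo 0 1))
    (hVZ : IntegrableOn (fun u => V u * Z u) (Ioo 0 1)) (hχ : ContDiff ℝ 1 χ)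
    (hχ1 : ∀ u, |χ u| ≤ 1) (hχa : χ a = 0) (hχb : χ b = 0)
    (hχZ : IntegrableOn (fun u => deriv χ u ^ 2 * Z u) (Ioo 0 1))
    (h : ∀ φ : ℝ → ℝ, ContDiff ℝ ∞ φ → HasCompactSupport φ → tsupport φ ⊆ Ioo a b →
      ∫ u in a..b, (f u - V u * W u) * φ u = c * ∫ u in a..b, W u * deriv (deriv φ) u) :
    ∃ w P, HasACDeriv a b w P ∧ HasACDeriv a b P (fun u => c⁻¹ * (f u - V u * W u)) ∧
      (∀ᵐ u, u ∈ uIoc a b → W u = w u) ∧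
      ∫ u in a..b, (deriv χ u * w u) ^ 2 ≤ ∫ u in Ioo (0 : ℝ) 1, deriv χ u ^ 2 * Z u ∧
      ∫ u in a..b, (χ u * P u) ^ 2 ≤ 4 * (∫ u in Ioo (0 : ℝ) 1, deriv χ u ^ 2 * Z u)
        + 2 * c⁻¹ * ∫ u in Ioo (0 : ℝ) 1, (1 + Z u + V u * Z u) := by
  have hsub : uIcc a b ⊆ uIcc (0 : ℝ) 1 := by
    rw [uIcc_of_le hab.le, uIcc_of_le zero_le_one]
    exact Icc_subset_Icc ha.le hb.le
  have hsub' : Ioc a b ⊆ Ioo 0 1 := fun u hu => ⟨ha.trans hu.1, hu.2.trans_lt hb⟩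
  have hVab : ContinuousOn V (uIcc a b) := by
    rw [uIcc_of_le hab.le]
    exact hV.mono fun u hu => ⟨ha.trans_le hu.1, hu.2.trans_lt hb⟩
  have hWab := hW.mono_set hsub
  have hfab := hf.mono_set hsub
  have hq : IntervalIntegrable (fun u => c⁻¹ * (f u - V u * W u)) volume a b :=
    (hfab.sub (hWab.continuousOn_mul hVab)).const_mul c⁻¹
  obtain ⟨w, P, hw, hP, hWw⟩ := exists_hasACDeriv_of_forall_integral_eq hab hWab hq
    fun φ h1 h2 h3 => by
      simp_rw [mul_assoc, intervalIntegral.integral_const_mul, h φ h1 h2 h3]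
      field_simp
  have hZ0 : ∀ u, 0 ≤ Z u := fun u => (sq_nonneg _).trans (hWZ u)
  have dom : ∀ {F G : ℝ → ℝ}, IntervalIntegrable F volume a b → IntegrableOn G (Ioo 0 1) →
      (∀ u ∈ Ioo (0 : ℝ) 1, 0 ≤ G u) → (∀ᵐ u, u ∈ Ioc a b → F u ≤ G u) →
      ∫ u in a..b, F u ≤ ∫ u in Ioo (0 : ℝ) 1, G u := by
    intro F G hF hG hG0 hle
    rw [intervalIntegral.integral_of_le hab.le]
    refine (integral_mono_ae ((intervalIntegrable_iff_integrableOn_Ioc_of_le hab.le).1 hF)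
      (hG.mono_set hsub') ((ae_restrict_iff' measurableSet_Ioc).2 hle)).trans ?_
    exact setIntegral_mono_set hG ((ae_restrict_iff' measurableSet_Ioo).2
      (Eventually.of_forall hG0)) (Eventually.of_forall hsub')
  have hD : ∫ u in a..b, (deriv χ u * w u) ^ 2 ≤ ∫ u in Ioo (0 : ℝ) 1, deriv χ u ^ 2 * Z u := by
    refine dom (((hχ.continuous_deriv le_rfl).continuousOn.mul hw.ac.continuousOn).pow
      2).intervalIntegrable hχZ (fun u _ => mul_nonneg (sq_nonneg _) (hZ0 u)) ?_
    filter_upwards [hWw] with u hu hu'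
    rw [mul_pow, ← hu (by rwa [uIoc_of_le hab.le])]
    exact mul_le_mul_of_nonneg_left (hWZ u) (sq_nonneg _)
  refine ⟨w, P, hw, hP, hWw, hD, ?_⟩
  refine (integral_sq_mul_deriv_sq_le hab.le hw hP hχ hχa hχb).trans ?_
  have hlow : ∫ u in a..b, -c * (χ u ^ 2 * (w u * (c⁻¹ * (f u - V u * W u))))
      ≤ ∫ u in Ioo (0 : ℝ) 1, (1 + Z u + V u * Z u) := by
    refine dom (((hq.continuousOn_mul hw.ac.continuousOn).continuousOn_mul
      (hχ.continuous.pow 2).continuousOn).const_mul (-c))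
      (((integrableOn_const (by simp)).add hZ).add hVZ) (fun u hu => ?_) ?_
    · have := mul_nonneg (hV0 u hu) (hZ0 u)
      have := hZ0 u
      positivity
    · filter_upwards [hWw] with u hu hu'
      rw [← hu (by rwa [uIoc_of_le hab.le])]
      have hu01 := hsub' hu'
      have e : -c * (χ u ^ 2 * (W u * (c⁻¹ * (f u - V u * W u))))
          = χ u ^ 2 * (- (W u * f u) + V u * W u ^ 2) := by
        field_simp
        ring
      have h1 : - (W u * f u) ≤ 1 + Z u := by
        have h2 := abs_le.1 (hf1 u hu01)
        nlinarith [hWZ u, sq_nonneg (W u + f u), h2.1, h2.2]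
      have h3 : V u * W u ^ 2 ≤ V u * Z u := mul_le_mul_of_nonneg_left (hWZ u) (hV0 u hu01)
      have h4 : χ u ^ 2 ≤ 1 := by
        rw [← sq_abs]
        exact pow_le_one₀ (abs_nonneg _) (hχ1 u)
      have h5 : 0 ≤ 1 + Z u + V u * Z u := by
        have := mul_nonneg (hV0 u hu01) (hZ0 u)
        have := hZ0 u
        positivity
      rw [e]
      calc χ u ^ 2 * (- (W u * f u) + V u * W u ^ 2) ≤ χ u ^ 2 * (1 + Z u + V u * Z u) :=
            mul_le_mul_of_nonneg_left (by linarith) (sq_nonneg _)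
        _ ≤ 1 * (1 + Z u + V u * Z u) := mul_le_mul_of_nonneg_right h4 h5
        _ = _ := one_mul _
  rw [intervalIntegral.integral_const_mul] at hlow
  set I := ∫ u in a..b, χ u ^ 2 * (w u * (c⁻¹ * (f u - V u * W u)))
  have h6 : -I ≤ c⁻¹ * ∫ u in Ioo (0 : ℝ) 1, (1 + Z u + V u * Z u) := by
    rw [inv_mul_eq_div, le_div_iff₀ hc]
    linarith
  linarith

/-- The near-symmetry of `c Δ + V` on functions that are small near the end points in the sense of a
majorant `Z` of their squares. For `c = 0` the right-hand side is zero (with `c⁻¹ = 0`). -/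
theorem integral_sq_mul_sub_le_of_reaction {c a b : ℝ} (hc : 0 ≤ c) (ha : 0 < a) (hab : a < b)
    (hb : b < 1) {W₁ f₁ W₂ f₂ V Z χ : ℝ → ℝ} (hW₁ : IntervalIntegrable W₁ volume 0 1)
    (hf₁ : IntervalIntegrable f₁ volume 0 1) (hf₁1 : ∀ u ∈ Ioo (0 : ℝ) 1, |f₁ u| ≤ 1)
    (hW₂ : IntervalIntegrable W₂ volume 0 1)
    (hf₂ : IntervalIntegrable f₂ volume 0 1) (hf₂1 : ∀ u ∈ Ioo (0 : ℝ) 1, |f₂ u| ≤ 1)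
    (hV : ContinuousOn V (Ioo 0 1)) (hV0 : ∀ u ∈ Ioo (0 : ℝ) 1, 0 ≤ V u)
    (hWZ₁ : ∀ u, W₁ u ^ 2 ≤ Z u) (hWZ₂ : ∀ u, W₂ u ^ 2 ≤ Z u) (hZ : IntegrableOn Z (Ioo 0 1))
    (hVZ : IntegrableOn (fun u => V u * Z u) (Ioo 0 1)) (hχ : ContDiff ℝ 1 χ)
    (hχ1 : ∀ u, |χ u| ≤ 1) (hχs : ∀ u, u ∉ Ioo a b → χ u = 0)
    (hχZ : IntegrableOn (fun u => deriv χ u ^ 2 * Z u) (Ioo 0 1))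
    (h₁ : ∀ φ : ℝ → ℝ, ContDiff ℝ ∞ φ → HasCompactSupport φ → tsupport φ ⊆ Ioo 0 1 →
      ∫ u in (0 : ℝ)..1, f₁ u * φ u = (c * ∫ u in (0 : ℝ)..1, W₁ u * deriv (deriv φ) u)
        + ∫ u in (0 : ℝ)..1, V u * W₁ u * φ u)
    (h₂ : ∀ φ : ℝ → ℝ, ContDiff ℝ ∞ φ → HasCompactSupport φ → tsupport φ ⊆ Ioo 0 1 →
      ∫ u in (0 : ℝ)..1, f₂ u * φ u = (c * ∫ u in (0 : ℝ)..1, W₂ u * deriv (deriv φ) u)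
        + ∫ u in (0 : ℝ)..1, V u * W₂ u * φ u) :
    ∫ u in (0 : ℝ)..1, χ u ^ 2 * (f₁ u * W₂ u - W₁ u * f₂ u)
      ≤ c * (4 * (√(∫ u in Ioo (0 : ℝ) 1, deriv χ u ^ 2 * Z u)
        * √(4 * (∫ u in Ioo (0 : ℝ) 1, deriv χ u ^ 2 * Z u)
          + 2 * c⁻¹ * ∫ u in Ioo (0 : ℝ) 1, (1 + Z u + V u * Z u)))) := by
  have hsub : uIcc a b ⊆ uIcc (0 : ℝ) 1 := by
    rw [uIcc_of_le hab.le, uIcc_of_le zero_le_one]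
    exact Icc_subset_Icc ha.le hb.le
  have hVab : ContinuousOn V (uIcc a b) := by
    rw [uIcc_of_le hab.le]
    exact hV.mono fun u hu => ⟨ha.trans_le hu.1, hu.2.trans_lt hb⟩
  have restr : ∀ F : ℝ → ℝ, (∀ u, u ∉ Ioo a b → F u = 0) →
      ∫ u in (0 : ℝ)..1, F u = ∫ u in a..b, F u := by
    intro F hF
    rw [intervalIntegral.integral_eq_integral_of_support_subset,
      intervalIntegral.integral_eq_integral_of_support_subset]
    all_goals
      intro u hu
      have : u ∈ Ioo a b := by
        by_contra hn
        exact hu (hF u hn)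
    · exact Ioo_subset_Ioc_self this
    · exact ⟨ha.trans this.1, (this.2.trans hb).le⟩
  have htest : ∀ {W f : ℝ → ℝ}, IntervalIntegrable W volume 0 1 → IntervalIntegrable f volume 0 1 →
      (∀ φ : ℝ → ℝ, ContDiff ℝ ∞ φ → HasCompactSupport φ → tsupport φ ⊆ Ioo 0 1 →
        ∫ u in (0 : ℝ)..1, f u * φ u = (c * ∫ u in (0 : ℝ)..1, W u * deriv (deriv φ) u)
          + ∫ u in (0 : ℝ)..1, V u * W u * φ u) →
      ∀ φ : ℝ → ℝ, ContDiff ℝ ∞ φ → HasCompactSupport φ → tsupport φ ⊆ Ioo a b →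
        ∫ u in a..b, (f u - V u * W u) * φ u = c * ∫ u in a..b, W u * deriv (deriv φ) u := by
    intro W f hW hf h φ h1 h2 h3
    have z : ∀ u, u ∉ Ioo a b → φ u = 0 := fun u hu =>
      image_eq_zero_of_notMem_tsupport fun h => hu (h3 h)
    have z' : ∀ u, u ∉ Ioo a b → deriv (deriv φ) u = 0 := fun u hu =>
      image_eq_zero_of_notMem_tsupport fun h =>
        hu (h3 (tsupport_deriv_subset (tsupport_deriv_subset h)))
    have e := h φ h1 h2 (h3.trans (Ioo_subset_Ioo ha.le hb.le))
    rw [restr _ fun u hu => by rw [z u hu, mul_zero], restr _ fun u hu => by rw [z' u hu, mul_zero],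
      restr _ fun u hu => by rw [z u hu, mul_zero]] at e
    have e2 : ∫ u in a..b, (f u - V u * W u) * φ u
        = (∫ u in a..b, f u * φ u) - ∫ u in a..b, V u * W u * φ u := by
      rw [← intervalIntegral.integral_sub
        ((hf.mono_set hsub).mul_continuousOn h1.continuous.continuousOn)
        (((hW.mono_set hsub).continuousOn_mul hVab).mul_continuousOn h1.continuous.continuousOn)]
      congr 1; ext u; ring
    rw [e2, e]
    ring
  rw [restr _ fun u hu => by rw [hχs u hu]; ring]
  rcases hc.eq_or_lt with rfl | hc
  · -- Without diffusion, `f = V W` almost everywhere and the integrand vanishes.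
    have hfV : ∀ {W f : ℝ → ℝ}, IntervalIntegrable W volume 0 1 →
        IntervalIntegrable f volume 0 1 →
        (∀ φ : ℝ → ℝ, ContDiff ℝ ∞ φ → HasCompactSupport φ → tsupport φ ⊆ Ioo a b →
          ∫ u in a..b, (f u - V u * W u) * φ u = 0 * ∫ u in a..b, W u * deriv (deriv φ) u) →
        ∀ᵐ u, u ∈ uIoc a b → f u - V u * W u = 0 := fun hW hf h =>
      ae_mem_uIoc_of_ae_mem_Ioo hab.le <| ae_eq_zero_of_forall_integral_mul_eq_zero hab
        ((hf.mono_set hsub).sub ((hW.mono_set hsub).continuousOn_mul hVab))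
        fun φ h1 h2 h3 => by rw [← zero_mul (∫ u in a..b, _), ← h φ h1 h2 h3]
    rw [zero_mul, intervalIntegral.integral_zero_ae]
    filter_upwards [hfV hW₁ hf₁ (htest hW₁ hf₁ h₁), hfV hW₂ hf₂ (htest hW₂ hf₂ h₂)]
      with u e1 e2 hu
    rw [sub_eq_zero.1 (e1 hu), sub_eq_zero.1 (e2 hu)]
    ring
  · have hχa : χ a = 0 := hχs a (by simp)
    have hχb : χ b = 0 := hχs b (by simp)
    obtain ⟨w₁, P₁, hw₁, hP₁, e₁, hD₁, hK₁⟩ := exists_hasACDeriv_of_reaction hc ha hab hb hW₁ hf₁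
      hf₁1 hV hV0 hWZ₁ hZ hVZ hχ hχ1 hχa hχb hχZ (htest hW₁ hf₁ h₁)
    obtain ⟨w₂, P₂, hw₂, hP₂, e₂, hD₂, hK₂⟩ := exists_hasACDeriv_of_reaction hc ha hab hb hW₂ hf₂
      hf₂1 hV hV0 hWZ₂ hZ hVZ hχ hχ1 hχa hχb hχZ (htest hW₂ hf₂ h₂)
    have key := abs_integral_sq_mul_sub_le hab.le hw₁ hP₁ hw₂ hP₂ hχ hχa hχb hD₁ hD₂ hK₁ hK₂
    -- The potential drops out of the antisymmetric combination.
    have e : ∫ u in a..b, χ u ^ 2 * (f₁ u * W₂ u - W₁ u * f₂ u)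
        = -c * ∫ u in a..b, χ u ^ 2 * (w₁ u * (c⁻¹ * (f₂ u - V u * W₂ u))
          - c⁻¹ * (f₁ u - V u * W₁ u) * w₂ u) := by
      rw [← intervalIntegral.integral_const_mul]
      refine intervalIntegral.integral_congr_ae ?_
      filter_upwards [e₁, e₂] with u h1 h2 hu
      rw [h1 hu, h2 hu]
      field_simp
      ring
    rw [e, neg_mul, ← mul_neg]
    exact mul_le_mul_of_nonneg_left ((neg_le_abs _).trans key) hc.le

/-- Smooth cutoff functions `χ_n ↑ 1` on `(0, 1)`, supported where `u (1 - u) ≥ 1 / (n + 3)`. -/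
noncomputable def cutoff (n : ℕ) (u : ℝ) : ℝ :=
  Real.smoothTransition ((n + 3) * (u * (1 - u)) - 1)

theorem contDiff_cutoff (n : ℕ) : ContDiff ℝ 1 (cutoff n) :=
  (Real.smoothTransition.contDiff (n := 1)).comp (by fun_prop)

theorem abs_cutoff_le_one (n : ℕ) (u : ℝ) : |cutoff n u| ≤ 1 := by
  rw [cutoff, abs_of_nonneg (Real.smoothTransition.nonneg _)]
  exact Real.smoothTransition.le_one _

theorem cutoff_eq_zero (n : ℕ) {u : ℝ} (hu : u ∉ Ioo (1 / ((n : ℝ) + 3)) (1 - 1 / ((n : ℝ) + 3))) :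
    cutoff n u = 0 := by
  refine Real.smoothTransition.zero_of_nonpos ?_
  have hn : (0 : ℝ) < n + 3 := by positivity
  have ha : ((n : ℝ) + 3) * (1 / ((n : ℝ) + 3)) = 1 := by field_simp
  set a := 1 / ((n : ℝ) + 3) with h
  have ha0 : 0 < a := by positivity
  have ha1 : a ≤ 1 / 3 := one_div_le_one_div_of_le (by norm_num) (by linarith [n.cast_nonneg (α := ℝ)])
  -- Off `(a, 1 - a)` one has `u (1 - u) ≤ a (1 - a) ≤ a`.
  have h2 : (u - a) * (1 - a - u) ≤ 0 := by
    rw [mem_Ioo, not_and_or, not_lt, not_lt] at hu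
    rcases hu with hu | hu <;> nlinarith
  have h3 : u * (1 - u) ≤ a := by nlinarith
  nlinarith

theorem deriv_smoothTransition_eq_zero {x : ℝ} (hx : x ∉ Icc (0 : ℝ) 1) :
    deriv Real.smoothTransition x = 0 := by
  rw [mem_Icc, not_and_or, not_le, not_le] at hx
  rcases hx with hx | hx
  · have : Real.smoothTransition =ᶠ[𝓝 x] fun _ => 0 := by
      filter_upwards [Iio_mem_nhds hx] with y hy
      exact Real.smoothTransition.zero_of_nonpos (le_of_lt hy)
    rw [this.deriv_eq, deriv_const]
  · have : Real.smoothTransition =ᶠ[𝓝 x] fun _ => 1 := by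
      filter_upwards [Ioi_mem_nhds hx] with y hy
      exact Real.smoothTransition.one_of_one_le (le_of_lt hy)
    rw [this.deriv_eq, deriv_const]

theorem deriv_cutoff (n : ℕ) (u : ℝ) :
    deriv (cutoff n) u = deriv Real.smoothTransition ((n + 3) * (u * (1 - u)) - 1)
      * ((n + 3) * (1 - 2 * u)) := by
  have h1 : HasDerivAt Real.smoothTransition (deriv Real.smoothTransition
      ((n + 3) * (u * (1 - u)) - 1)) ((n + 3) * (u * (1 - u)) - 1) :=
    ((Real.smoothTransition.contDiff (n := 1)).differentiable one_ne_zero _).hasDerivAt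
  have h2 : HasDerivAt (fun u : ℝ => ((n : ℝ) + 3) * (u * (1 - u)) - 1)
      (((n : ℝ) + 3) * (1 - 2 * u)) u := by
    have := (((hasDerivAt_id u).mul ((hasDerivAt_id u).const_sub 1)).const_mul
      ((n : ℝ) + 3)).sub_const 1
    refine this.congr_deriv ?_
    simp only [id]; ring
  exact (h1.comp u h2).deriv

/-- At a fixed interior point, `χ_n = 1` and `χ_n' = 0` for all large `n`. -/
theorem eventually_cutoff_eq_one {u : ℝ} (hu : u ∈ Ioo (0 : ℝ) 1) :
    ∀ᶠ n in atTop, cutoff n u = 1 ∧ deriv (cutoff n) u = 0 := by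
  have hp : 0 < u * (1 - u) := mul_pos hu.1 (by linarith [hu.2])
  obtain ⟨N, hN⟩ := exists_nat_gt (2 / (u * (1 - u)))
  filter_upwards [eventually_ge_atTop N] with n hn
  have h1 : 2 < (n : ℝ) * (u * (1 - u)) := by
    rw [div_lt_iff₀ hp] at hN
    have : (N : ℝ) ≤ n := by exact_mod_cast hn
    nlinarith
  have h2 : 1 < ((n : ℝ) + 3) * (u * (1 - u)) - 1 := by linarith
  refine ⟨Real.smoothTransition.one_of_one_le h2.le, ?_⟩
  rw [deriv_cutoff, deriv_smoothTransition_eq_zero (fun h => absurd h.2 (not_le.2 h2)), zero_mul]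

/-- `1 / u² + 1 / (1 - u)²`, the weight in the energy condition. -/
noncomputable def hardyWeight (u : ℝ) : ℝ := 1 / u ^ 2 + 1 / (1 - u) ^ 2

/-- Where `χ_n' ≠ 0` one has `n + 3 ≤ 2 / (u (1 - u))`, so `|χ_n'| ≤ C / (u (1 - u))` with `C`
independent of `n`. -/
theorem exists_deriv_cutoff_sq_le :
    ∃ C, 0 ≤ C ∧ ∀ n, ∀ u ∈ Ioo (0 : ℝ) 1, deriv (cutoff n) u ^ 2 ≤ C * hardyWeight u := by
  have hcont : Continuous (deriv Real.smoothTransition) :=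
    (Real.smoothTransition.contDiff (n := 1)).continuous_deriv le_rfl
  obtain ⟨M, hM⟩ := isCompact_Icc.exists_bound_of_continuousOn (s := Icc (0 : ℝ) 1)
    hcont.continuousOn
  refine ⟨8 * M ^ 2, by positivity, fun n u hu => ?_⟩
  have h1u : 0 < 1 - u := by linarith [hu.2]
  have hw : 0 ≤ hardyWeight u := by unfold hardyWeight; positivity
  rw [deriv_cutoff]
  by_cases hx : ((n : ℝ) + 3) * (u * (1 - u)) - 1 ∈ Icc (0 : ℝ) 1
  · have hMx := hM _ hx
    set D := deriv Real.smoothTransition (((n : ℝ) + 3) * (u * (1 - u)) - 1)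
    have hD : D ^ 2 ≤ M ^ 2 := by
      rw [← sq_abs]
      exact pow_le_pow_left₀ (abs_nonneg _) hMx 2
    have hn : ((n : ℝ) + 3) ≤ 2 * (1 / u + 1 / (1 - u)) := by
      have e : 2 * (1 / u + 1 / (1 - u)) = 2 / (u * (1 - u)) := by
        have h0 := hu.1.ne'
        have h1 := h1u.ne'
        field_simp
        ring
      rw [e, le_div_iff₀ (mul_pos hu.1 h1u)]
      linarith [hx.2]
    have hn2 : (((n : ℝ) + 3) * (1 - 2 * u)) ^ 2 ≤ 8 * hardyWeight u := by
      have h3 : (((n : ℝ) + 3) * (1 - 2 * u)) ^ 2 ≤ ((n : ℝ) + 3) ^ 2 := by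
        rw [mul_pow]
        have : (1 - 2 * u) ^ 2 ≤ 1 := by nlinarith [hu.1]
        nlinarith [sq_nonneg ((n : ℝ) + 3)]
      have h4 : ((n : ℝ) + 3) ^ 2 ≤ (2 * (1 / u + 1 / (1 - u))) ^ 2 :=
        pow_le_pow_left₀ (by positivity) hn 2
      have h5 : (2 * (1 / u + 1 / (1 - u))) ^ 2 ≤ 8 * hardyWeight u := by
        have e : hardyWeight u = (1 / u) ^ 2 + (1 / (1 - u)) ^ 2 := by
          rw [hardyWeight, one_div_pow, one_div_pow]
        rw [e]
        nlinarith [sq_nonneg (1 / u - 1 / (1 - u))]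
      linarith
    rw [mul_pow]
    calc D ^ 2 * (((n : ℝ) + 3) * (1 - 2 * u)) ^ 2 ≤ M ^ 2 * (8 * hardyWeight u) := by gcongr
      _ = _ := by ring
  · rw [deriv_smoothTransition_eq_zero hx]
    simp only [zero_mul, zero_pow two_ne_zero]
    positivity

end Reaction

/-! ### Uniqueness for the reaction–diffusion equation -/

section Reaction

variable {T c κ α β : ℝ} {g : ℝ → ℝ} {r ρ ρ₁ ρ₂ : ℝ → ℝ → ℝ}

theorem IsDensity.integrable_energy (h : IsDensity T ρ)
    (hE : ∫⁻ s in Icc (0 : ℝ) T, ∫⁻ u in Ioo (0 : ℝ) 1,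
      ENNReal.ofReal ((α - ρ s u) ^ 2 / u ^ 2 + (β - ρ s u) ^ 2 / (1 - u) ^ 2) < ⊤) :
    Integrable (fun p : ℝ × ℝ => (α - ρ p.1 p.2) ^ 2 / p.2 ^ 2
        + (β - ρ p.1 p.2) ^ 2 / (1 - p.2) ^ 2)
      ((volume.restrict (Icc 0 T)).prod (volume.restrict (Ioo 0 1))) := by
  have hm : AEMeasurable (fun p : ℝ × ℝ => ρ p.1 p.2)
      ((volume.restrict (Icc 0 T)).prod (volume.restrict (Ioo 0 1))) := by
    rw [Measure.prod_restrict]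
    exact h.meas.mono_measure (Measure.restrict_mono_set _ (prod_mono le_rfl Ioo_subset_Icc_self))
  have hm' : AEMeasurable (fun p : ℝ × ℝ => (α - ρ p.1 p.2) ^ 2 / p.2 ^ 2
        + (β - ρ p.1 p.2) ^ 2 / (1 - p.2) ^ 2)
      ((volume.restrict (Icc 0 T)).prod (volume.restrict (Ioo 0 1))) := by
    fun_prop
  refine ⟨hm'.aestronglyMeasurable, ?_⟩
  rw [hasFiniteIntegral_iff_ofReal (Eventually.of_forall fun p => by positivity),
    lintegral_prod _ hm'.ennreal_ofReal]
  exact hE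

/-- The energy condition carries over to the difference of two solutions. -/
theorem integrable_sq_mul_hardyWeight (hr : Measurable (Function.uncurry r))
    (hrρ : ∀ᵐ p ∂((volume.restrict (Icc 0 T)).prod (volume.restrict (Icc (0 : ℝ) 1))),
      r p.1 p.2 = ρ₁ p.1 p.2 - ρ₂ p.1 p.2)
    (h₁ : IsWeakSolReac T c κ α β g ρ₁) (h₂ : IsWeakSolReac T c κ α β g ρ₂) (hκ : 0 < κ) :
    Integrable (fun p : ℝ × ℝ => r p.1 p.2 ^ 2 * hardyWeight p.2)
      ((volume.restrict (Icc 0 T)).prod (volume.restrict (Ioo 0 1))) := by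
  have hrρ' : ∀ᵐ p ∂((volume.restrict (Icc 0 T)).prod (volume.restrict (Ioo (0 : ℝ) 1))),
      r p.1 p.2 = ρ₁ p.1 p.2 - ρ₂ p.1 p.2 := by
    rwa [Measure.restrict_congr_set Ioo_ae_eq_Icc]
  refine (((h₁.density.integrable_energy (h₁.energy hκ)).add
    (h₂.density.integrable_energy (h₂.energy hκ))).const_mul 2).mono' ?_ ?_
  · have hw : Measurable hardyWeight := by unfold hardyWeight; fun_prop
    exact ((hr.pow_const 2).mul (hw.comp measurable_snd)).aestronglyMeasurable
  · filter_upwards [hrρ'] with p hp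
    have hw : 0 ≤ r p.1 p.2 ^ 2 * hardyWeight p.2 := by unfold hardyWeight; positivity
    rw [Real.norm_eq_abs, abs_of_nonneg hw, hp, hardyWeight, mul_add, mul_one_div, mul_one_div]
    simp only [Pi.add_apply]
    have e : ∀ γ x y z : ℝ, 0 ≤ z → (x - y) ^ 2 / z ≤ 2 * ((γ - x) ^ 2 / z + (γ - y) ^ 2 / z) := by
      intro γ x y z hz
      rw [← add_div, ← mul_div_assoc]
      gcongr
      nlinarith [sq_nonneg ((γ - x) + (γ - y))]
    have e1 := e α (ρ₁ p.1 p.2) (ρ₂ p.1 p.2) (p.2 ^ 2) (by positivity)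
    have e2 := e β (ρ₁ p.1 p.2) (ρ₂ p.1 p.2) ((1 - p.2) ^ 2) (by positivity)
    linarith

/-- The Cauchy–Schwarz inequality for `∫₀ᵗ r_s(u) ds`, uniformly in `t ≤ T`. -/
theorem timeIntegral_sq_le (hr : Measurable (Function.uncurry r)) (hb : ∀ s u, |r s u| ≤ 1)
    {t : ℝ} (ht : t ∈ Icc 0 T) (u : ℝ) :
    timeIntegral r t u ^ 2 ≤ T * ∫ s in Icc 0 T, r s u ^ 2 := by
  have hm : Measurable fun s => r s u := hr.comp (by fun_prop : Measurable fun s : ℝ => (s, u))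
  have hi := intervalIntegrable_slice hr hb u 0 t
  have hi2 : IntegrableOn (fun s => r s u ^ 2) (Icc 0 T) :=
    Integrable.of_bound (C := 1) (hm.pow_const 2).aestronglyMeasurable
      (Eventually.of_forall fun s => by
        rw [norm_pow, Real.norm_eq_abs]
        exact pow_le_one₀ (abs_nonneg _) (hb s u))
  have hsub : Ioc 0 t ⊆ Icc 0 T := Ioc_subset_Icc_self.trans (Icc_subset_Icc_right ht.2)
  have hi3 : IntervalIntegrable (fun s => r s u ^ 2) volume 0 t := by
    rw [intervalIntegrable_iff_integrableOn_Ioc_of_le ht.1]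
    exact hi2.mono_set hsub
  have hle : ∫ s in (0 : ℝ)..t, r s u ^ 2 ≤ ∫ s in Icc 0 T, r s u ^ 2 := by
    rw [intervalIntegral.integral_of_le ht.1]
    exact setIntegral_mono_set hi2 (Eventually.of_forall fun s => sq_nonneg _)
      (Eventually.of_forall hsub)
  have h0 : 0 ≤ ∫ s in (0 : ℝ)..t, r s u ^ 2 :=
    intervalIntegral.integral_nonneg ht.1 fun s _ => sq_nonneg _
  have key := abs_integral_mul_le_sqrt_mul_sqrt ht.1 (f := fun _ => 1) (g := fun s => r s u)
    (by simp) hi3 (by simpa using hi)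
  simp only [one_pow, one_mul, intervalIntegral.integral_const, sub_zero, smul_eq_mul,
    mul_one] at key
  rw [← Real.sqrt_mul ht.1, ← timeIntegral] at key
  calc timeIntegral r t u ^ 2 = |timeIntegral r t u| ^ 2 := (sq_abs _).symm
    _ ≤ √(t * ∫ s in (0 : ℝ)..t, r s u ^ 2) ^ 2 := pow_le_pow_left₀ (abs_nonneg _) key 2
    _ = t * ∫ s in (0 : ℝ)..t, r s u ^ 2 := Real.sq_sqrt (mul_nonneg ht.1 h0)
    _ ≤ T * ∫ s in Icc 0 T, r s u ^ 2 := mul_le_mul ht.2 hle h0 (ht.1.trans ht.2)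

theorem c₂_nonneg : 0 ≤ c₂ := inv_nonneg.2 (tsum_nonneg fun _ => by positivity)

theorem V₁_nonneg (u : ℝ) : 0 ≤ V₁ u := by
  have := c₂_nonneg
  unfold V₁ rMinus rPlus
  positivity

theorem V₁_eq (u : ℝ) : V₁ u = c₂ / 2 * hardyWeight u := by
  rw [V₁, rMinus, rPlus, hardyWeight, mul_add, div_mul_div_comm, div_mul_div_comm, mul_one]

theorem one_le_hardyWeight {u : ℝ} (hu : u ∈ Ioo (0 : ℝ) 1) : 1 ≤ hardyWeight u := by
  have h1 : 1 ≤ 1 / u ^ 2 :=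
    (one_le_div₀ (pow_pos hu.1 2)).2 (pow_le_one₀ hu.1.le hu.2.le)
  have h2 : 0 ≤ 1 / (1 - u) ^ 2 := by positivity
  rw [hardyWeight]
  linarith

theorem continuousOn_rMinus : ContinuousOn rMinus (Ioo 0 1) := by
  unfold rMinus
  exact continuousOn_const.div (by fun_prop) fun u hu => by have := hu.1; positivity

theorem continuousOn_rPlus : ContinuousOn rPlus (Ioo 0 1) := by
  unfold rPlus
  refine continuousOn_const.div (by fun_prop) fun u hu => ?_
  have : 0 < 1 - u := by linarith [hu.2]
  positivity

theorem continuousOn_V₁ : ContinuousOn V₁ (Ioo 0 1) := continuousOn_rMinus.add continuousOn_rPlus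

theorem continuousOn_V₀ : ContinuousOn (V₀ α β) (Ioo 0 1) :=
  (continuousOn_const.mul continuousOn_rMinus).add (continuousOn_const.mul continuousOn_rPlus)

theorem integrable_mul_of_tsupport_subset {V φ : ℝ → ℝ} (hV : ContinuousOn V (Ioo 0 1))
    (hφ : Continuous φ) (hc : HasCompactSupport φ) (hs : tsupport φ ⊆ Ioo 0 1) :
    Integrable (fun u => φ u * V u) := by
  rw [← integrableOn_iff_integrable_of_support_subset (s := tsupport φ)]
  · exact (hφ.continuousOn.mul (hV.mono hs)).integrableOn_compact hc
  · intro u hu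
    by_contra hn
    exact hu (by simp [image_eq_zero_of_notMem_tsupport hn])

theorem c12c_const {φ : ℝ → ℝ} (hφ : ContDiff ℝ 2 φ) (hc : HasCompactSupport φ)
    (hs : tsupport φ ⊆ Ioo 0 1) : C12c T (fun _ => φ) :=
  ⟨c12_const T hφ, tsupport φ, hc, hs, fun _ _ _ _ hu => image_eq_zero_of_notMem_tsupport hu⟩

/-- The equation for the difference of two solutions, integrated in time. The reaction enters as
`+ κ V₁`, with the sign that it has in `IsWeakSolReac.weak`. -/
theorem IsWeakSolReac.integral_sub_mul_eq (h₁ : IsWeakSolReac T c κ α β g ρ₁)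
    (h₂ : IsWeakSolReac T c κ α β g ρ₂) (hr : Measurable (Function.uncurry r))
    (hb : ∀ s u, |r s u| ≤ 1)
    (hrρ : ∀ᵐ s, s ∈ Icc 0 T → ∀ᵐ u, u ∈ Icc (0 : ℝ) 1 → r s u = ρ₁ s u - ρ₂ s u)
    {t : ℝ} (ht : t ∈ Icc 0 T) {φ : ℝ → ℝ} (hφ : ContDiff ℝ ∞ φ) (hc : HasCompactSupport φ)
    (hs : tsupport φ ⊆ Ioo 0 1) :
    ∫ u in (0 : ℝ)..1, (ρ₁ t u - ρ₂ t u) * φ u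
      = (c * ∫ u in (0 : ℝ)..1, timeIntegral r t u * deriv (deriv φ) u)
        + ∫ u in (0 : ℝ)..1, κ * V₁ u * timeIntegral r t u * φ u := by
  have hφ2 : ContDiff ℝ 2 φ := contDiff_infty.1 hφ 2
  have i0 := integrable_mul_of_tsupport_subset (continuousOn_V₀ (α := α) (β := β))
    hφ.continuous hc hs
  have i1 := integrable_mul_of_tsupport_subset continuousOn_V₁ hφ.continuous hc hs
  have hG : C12c T (fun _ => φ) := c12c_const hφ2 hc hs
  have w₁ := h₁.weak t ht _ hG
  have w₂ := h₂.weak t ht _ hG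
  have split : ∀ {ρ}, IsDensity T ρ →
      ∫ s in (0 : ℝ)..t, pair φ (fun u => V₀ α β u - V₁ u * ρ s u)
        = (∫ s in (0 : ℝ)..t, ∫ u in (0 : ℝ)..1, φ u * V₀ α β u)
          - ∫ s in (0 : ℝ)..t, pair (ρ s) (fun u => φ u * V₁ u) := by
    intro ρ hρ
    rw [← intervalIntegral.integral_sub (by simp)
      (hρ.intervalIntegrable_pair i1.integrableOn ht)]
    refine intervalIntegral.integral_congr fun s hs => ?_
    rw [uIcc_of_le ht.1] at hs
    simp only [pair]
    rw [← intervalIntegral.integral_sub i0.intervalIntegrable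
      (hρ.intervalIntegrable_mul i1.integrableOn ⟨hs.1, hs.2.trans ht.2⟩)]
    congr 1; ext u; ring
  rw [split h₁.density] at w₁
  rw [split h₂.density] at w₂
  have e := heatFunctional_sub_heatFunctional h₁.density h₂.density hr hb hrρ c g hφ2 ht
  have e' := integral_pair_sub_integral_pair h₁.density h₂.density hr hb hrρ i1.integrableOn ht
  have e2 : ∫ u in (0 : ℝ)..1, κ * V₁ u * timeIntegral r t u * φ u
      = κ * ∫ u in (0 : ℝ)..1, timeIntegral r t u * (φ u * V₁ u) := by
    rw [← intervalIntegral.integral_const_mul]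
    congr 1; ext u; ring
  rw [e2, ← e']
  linear_combination w₁ - w₂ - e

/-- The cutoff error vanishes in the limit, by dominated convergence with majorant
`Z / u² + Z / (1 - u)²`. -/
theorem tendsto_integral_deriv_cutoff_sq_mul {Z : ℝ → ℝ} (hZ : Measurable Z) (hZ0 : ∀ u, 0 ≤ Z u)
    (hZw : IntegrableOn (fun u => Z u * hardyWeight u) (Ioo 0 1)) :
    (∀ n, IntegrableOn (fun u => deriv (cutoff n) u ^ 2 * Z u) (Ioo 0 1)) ∧
    Tendsto (fun n => ∫ u in Ioo (0 : ℝ) 1, deriv (cutoff n) u ^ 2 * Z u) atTop (𝓝 0) := by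
  obtain ⟨C, hC, hle⟩ := exists_deriv_cutoff_sq_le
  have hm : ∀ n, AEStronglyMeasurable (fun u => deriv (cutoff n) u ^ 2 * Z u)
      (volume.restrict (Ioo 0 1)) := fun n =>
    ((((contDiff_cutoff n).continuous_deriv le_rfl).measurable.pow_const 2).mul
      hZ).aestronglyMeasurable
  have hbd : ∀ n, ∀ᵐ u ∂(volume.restrict (Ioo (0 : ℝ) 1)),
      ‖deriv (cutoff n) u ^ 2 * Z u‖ ≤ C * (Z u * hardyWeight u) := by
    intro n
    rw [ae_restrict_iff' measurableSet_Ioo]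
    refine Eventually.of_forall fun u hu => ?_
    rw [Real.norm_eq_abs, abs_of_nonneg (mul_nonneg (sq_nonneg _) (hZ0 u))]
    have := mul_le_mul_of_nonneg_right (hle n u hu) (hZ0 u)
    linarith
  refine ⟨fun n => (hZw.const_mul C).mono' (hm n) (hbd n), ?_⟩
  have hlim := tendsto_integral_of_dominated_convergence (f := fun _ => (0 : ℝ)) _ hm
    (hZw.const_mul C) hbd ?_
  · simpa using hlim
  rw [ae_restrict_iff' measurableSet_Ioo]
  refine Eventually.of_forall fun u hu => tendsto_const_nhds.congr' ?_
  filter_upwards [eventually_cutoff_eq_one hu] with n hn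
  rw [hn.2]
  ring

theorem IsWeakSolReac.ae_eq (hc : 0 ≤ c) (hκ : 0 < κ) (h₁ : IsWeakSolReac T c κ α β g ρ₁)
    (h₂ : IsWeakSolReac T c κ α β g ρ₂) {t : ℝ} (ht : t ∈ Icc 0 T) :
    ρ₁ t =ᵐ[volume.restrict (Icc 0 1)] ρ₂ t := by
  obtain ⟨r, hr, hb, hrρ, hrρ'⟩ := h₁.density.exists_measurable_sub h₂.density
  have hI := integrable_sq_mul_hardyWeight hr hrρ' h₁ h₂ hκ
  set Z : ℝ → ℝ := fun u => T * ∫ s in Icc 0 T, r s u ^ 2 with hZ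
  have hT : 0 ≤ T := ht.1.trans ht.2
  have hZm : Measurable Z :=
    ((hr.pow_const 2).stronglyMeasurable.integral_prod_left').measurable.const_mul T
  have hZ0 : ∀ u, 0 ≤ Z u := fun u =>
    mul_nonneg hT (integral_nonneg fun s => sq_nonneg _)
  have hZw : IntegrableOn (fun u => Z u * hardyWeight u) (Ioo 0 1) := by
    refine (hI.integral_prod_right.const_mul T).congr (Eventually.of_forall fun u => ?_)
    simp only [hZ, integral_mul_const]
    ring
  obtain ⟨hcut, hlim⟩ := tendsto_integral_deriv_cutoff_sq_mul hZm hZ0 hZw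
  have hd : ∀ s ∈ Icc 0 T, IntervalIntegrable (fun u => ρ₁ s u - ρ₂ s u) volume 0 1 :=
    fun s hs => (h₁.density.intervalIntegrable_slice hs).sub (h₂.density.intervalIntegrable_slice hs)
  have hd1 : ∀ s ∈ Icc 0 T, ∀ u ∈ Ioo (0 : ℝ) 1, |ρ₁ s u - ρ₂ s u| ≤ 1 := by
    intro s hs u hu
    have m1 := h₁.density.mem s hs u (Ioo_subset_Icc_self hu)
    have m2 := h₂.density.mem s hs u (Ioo_subset_Icc_self hu)
    rw [abs_le]
    constructor <;> linarith [m1.1, m1.2, m2.1, m2.2]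
  have hZi : IntegrableOn Z (Ioo 0 1) := by
    refine hZw.mono' hZm.aestronglyMeasurable ?_
    rw [ae_restrict_iff' measurableSet_Ioo]
    refine Eventually.of_forall fun u hu => ?_
    rw [Real.norm_eq_abs, abs_of_nonneg (hZ0 u)]
    exact le_mul_of_one_le_right (hZ0 u) (one_le_hardyWeight hu)
  have hVZ : IntegrableOn (fun u => κ * V₁ u * Z u) (Ioo 0 1) := by
    refine (hZw.const_mul (κ * (c₂ / 2))).congr (Eventually.of_forall fun u => ?_)
    simp only [V₁_eq]
    ring
  have hVc : ContinuousOn (fun u => κ * V₁ u) (Ioo 0 1) := continuousOn_const.mul continuousOn_V₁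
  have hid : ∀ s ∈ Icc 0 T, ∀ φ : ℝ → ℝ, ContDiff ℝ ∞ φ → HasCompactSupport φ →
      tsupport φ ⊆ Ioo 0 1 → _ := fun s hs φ a1 a2 a3 =>
    h₁.integral_sub_mul_eq h₂ hr hb hrρ hs a1 a2 a3
  have hW := timeIntegral_ae_eq_zero hr hb (T := T) (χ := fun n u => cutoff n u ^ 2)
    (ε := fun n => c * (4 * (√(∫ u in Ioo (0 : ℝ) 1, deriv (cutoff n) u ^ 2 * Z u)
      * √(4 * (∫ u in Ioo (0 : ℝ) 1, deriv (cutoff n) u ^ 2 * Z u)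
        + 2 * c⁻¹ * ∫ u in Ioo (0 : ℝ) 1, (1 + Z u + κ * V₁ u * Z u)))))
    (fun n => (contDiff_cutoff n).continuous.measurable.pow_const 2)
    (fun n u => by rw [abs_pow]; exact pow_le_one₀ (abs_nonneg _) (abs_cutoff_le_one n u))
    (fun u hu => tendsto_const_nhds.congr' (by
      filter_upwards [eventually_cutoff_eq_one hu] with n hn
      rw [hn.1, one_pow]))
    (by simpa using ((hlim.sqrt.mul ((hlim.const_mul 4).add_const
      (2 * c⁻¹ * ∫ u in Ioo (0 : ℝ) 1, (1 + Z u + κ * V₁ u * Z u))).sqrt).const_mul 4).const_mul c)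
    hrρ
    (fun n s hsT s' hsT' hs hs' => by
      have hn : (0 : ℝ) < n + 3 := by positivity
      have hn3 : 1 / ((n : ℝ) + 3) ≤ 1 / 3 :=
        one_div_le_one_div_of_le (by norm_num) (by linarith [n.cast_nonneg (α := ℝ)])
      have hn0 : 0 < 1 / ((n : ℝ) + 3) := by positivity
      have en := integral_sq_mul_sub_le_of_reaction hc hn0
        (b := 1 - 1 / ((n : ℝ) + 3)) (by linarith) (by linarith)
        (intervalIntegrable_timeIntegral hr hb s 0 1) (hd s hsT) (hd1 s hsT)
        (intervalIntegrable_timeIntegral hr hb s' 0 1) (hd s' hsT') (hd1 s' hsT') hVc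
        (fun u _ => mul_nonneg hκ.le (V₁_nonneg u)) (timeIntegral_sq_le hr hb hsT)
        (timeIntegral_sq_le hr hb hsT') hZi hVZ (contDiff_cutoff n) (abs_cutoff_le_one n)
        (fun u hu => cutoff_eq_zero n hu) (hcut n) (hid s hsT) (hid s' hsT')
      refine (le_of_eq (intervalIntegral.integral_congr_ae ?_)).trans en
      filter_upwards [hs hsT, hs' hsT'] with u hu hu1 hu'
      rw [uIoc_of_le zero_le_one] at hu'
      rw [hu (Ioc_subset_Icc_self hu'), hu1 (Ioc_subset_Icc_self hu')]) ht
  refine ae_restrict_Icc_eq_of_sub_eq_zero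
    (ae_eq_zero_of_forall_integral_mul_eq_zero zero_lt_one (hd t ht) fun φ a1 a2 a3 => ?_)
  have hW' := ae_mem_uIoc_of_ae_mem_Ioo zero_le_one hW
  rw [hid t ht φ a1 a2 a3, intervalIntegral.integral_zero_ae, intervalIntegral.integral_zero_ae]
  · ring
  · filter_upwards [hW'] with u hu hu'
    rw [hu hu']; ring
  · filter_upwards [hW'] with u hu hu'
    rw [hu hu']; ring

end Reaction

end WeakSol

theorem mainTheorem4 (T : ℝ) (hT : 0 < T)
    (α β : ℝ) (hα : α ∈ Icc (0 : ℝ) 1) (hβ : β ∈ Icc (0 : ℝ) 1)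
    (g : ℝ → ℝ) (hg : AEMeasurable g (volume.restrict (Icc 0 1)))
    (hg01 : ∀ u ∈ Icc (0 : ℝ) 1, g u ∈ Icc (0 : ℝ) 1) :
    (∀ c m : ℝ, 0 < c → 0 ≤ m → ∀ ρ₁ ρ₂ : ℝ → ℝ → ℝ,
      WeakSol.IsWeakSolRobin T c m α β g ρ₁ → WeakSol.IsWeakSolRobin T c m α β g ρ₂ →
      ∀ t ∈ Icc (0 : ℝ) T, ρ₁ t =ᵐ[volume.restrict (Icc 0 1)] ρ₂ t) ∧
    (∀ c m : ℝ, 0 < c → 0 ≤ m → ∀ ρ₁ ρ₂ : ℝ → ℝ → ℝ,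
      WeakSol.IsWeakSolRobinHom T c m α β g ρ₁ → WeakSol.IsWeakSolRobinHom T c m α β g ρ₂ →
      ∀ t ∈ Icc (0 : ℝ) T, ρ₁ t =ᵐ[volume.restrict (Icc 0 1)] ρ₂ t) ∧
    (∀ c κ : ℝ, 0 ≤ c → 0 < κ → ∀ ρ₁ ρ₂ : ℝ → ℝ → ℝ,
      WeakSol.IsWeakSolReac T c κ α β g ρ₁ → WeakSol.IsWeakSolReac T c κ α β g ρ₂ →
      ∀ t ∈ Icc (0 : ℝ) T, ρ₁ t =ᵐ[volume.restrict (Icc 0 1)] ρ₂ t) :=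
  ⟨fun _ _ hc hm _ _ h₁ h₂ _ ht => h₁.ae_eq hc hm h₂ ht,
    fun _ _ hc _ _ _ h₁ h₂ _ ht => h₁.ae_eq hc h₂ ht,
    fun _ _ hc hκ _ _ h₁ h₂ _ ht => h₁.ae_eq hc hκ h₂ ht⟩
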